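/- A $\lambda$-graph system $\mathfrak L=(V,E,\lambda,\iota)$ over a finite alphabet $\Sigma$ consists of finite vertex sets $V_l$ ($l\ge 0$), finite sets $E_{l,l+1}$ of edges $e$ with source $s(e)\in V_l$, terminal $t(e)\in V_{l+1}$ and label $\lambda(e)\in\Sigma$, such that every vertex emits an edge and every vertex of level $l\ge 1$ receives one, and surjections $\iota:V_{l+1}\to V_l$ such that for all $u\in V_l$, $v\in V_{l+2}$ there is a label-preserving bijection between $\{e\in E_{l+1,l+2}: \iota(s(e))=u,\ t(e)=v\}$ and $\{e\in E_{l,l+1}: s(e)=u,\ t(e)=\iota(v)\}$. It is left-resolving if an edge in $E_{l,l+1}$ is determined by its label and its terminal, and it satisfies condition (I) if at least two distinct infinite label sequences leave each vertex. Let $\mathfrak L$ be left-resolving. Put $\Omega_{\mathfrak L}=\varprojlim(V_l,\iota)$, and let $E_{\mathfrak L}$ be the set of triples $(u,\alpha,v)\in\Omega_{\mathfrak L}\times\Sigma\times\Omega_{\mathfrak L}$ such that for every $l$ there is an edge in $E_{l,l+1}$ from $u^l$ to $v^{l+1}$ with label $\alpha$. Let $X_{\mathfrak L}$ be the compact space of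 sequences $x=(\alpha_i,v_i)_{i\ge1}$ in $\Sigma\times\Omega_{\mathfrak L}$ with $(v_{i},\alpha_{i+1},v_{i+1})\in E_{\mathfrak L}$ for all $i\ge 1$ and $(v_0,\alpha_1,v_1)\in E_{\mathfrak L}$ for some (necessarily unique) $v_0=v(x)_0\in\Omega_{\mathfrak L}$, and let $\sigma_{\mathfrak L}$ be the shift on $X_{\mathfrak L}$. Let $G_{\mathfrak L}=\{(x,p-q,z): p,q\ge 0,\ \sigma_{\mathfrak L}^p(x)=\sigma_{\mathfrak L}^q(z)\}$ be its Deaconu--Renault groupoid, an étale groupoid, and $\mathcal O_{\mathfrak L}=C^*_r(G_{\mathfrak L})$ its reduced $C^*$-algebra, that is, the closure of the image of $C_c(G_{\mathfrak L})$ under the left regular representation. In $\mathcal O_{\mathfrak L}$ let $S_\alpha$ ($\alpha\in\Sigma$) and $E_v$ ($v\in V_l$) be the images of the characteristic functions of $\{(x,1,\sigma_{\mathfrak L}(x)):\alpha_1(x)=\alpha\}$ and $\{(x,0,x): v(x)_0^l=v\}$, and put $S_\mu=S_{\mu_1}\cdots S_{\mu_m}$. Let $\mathcal D_{\mathfrak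 L}$ be the $C^*$-subalgebra generated by all $S_\mu E_vS_\mu^*$, where $v$ is a vertex and $\mu$ is the label sequence of a finite path of $\mathfrak L$. The functions $g\in C(X_{\mathfrak L})$ are regarded as elements of $\mathcal O_{\mathfrak L}$ by extending them by zero from the unit space $X_{\mathfrak L}$ to $G_{\mathfrak L}$; in this way $\mathcal D_{\mathfrak L}=C(X_{\mathfrak L})$. For $f\in C(X_{\mathfrak L},\mathbb Z)$ and $t\in\mathbb R/\mathbb Z$ let $\rho^{\mathfrak L,f}_t=\mathrm{Ad}(U_t(f))\in\mathrm{Aut}(\mathcal O_{\mathfrak L})$, where $U_t(f)$ is multiplication by $\exp(2\pi\sqrt{-1}\,t f_G)$ on $\ell^2(G_{\mathfrak L})$ and $f_G(x,p-q,z)=\sum_{i=0}^{p-1}f(\sigma_{\mathfrak L}^i(x))-\sum_{j=0}^{q-1}f(\sigma_{\mathfrak L}^j(z))$ whenever $\sigma_{\mathfrak L}^p(x)=\sigma_{\mathfrak L}^q(z)$. **Proposition.** Let $\mathfrak L_1,\mathfrak L_2$ be left-resolving $\lambda$-graph systems satisfying condition (I). Let $h:X_{\mathfrak L_1}\to X_{\mathfrak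 L_2}$ be a homeomorphism and let $k_i,l_i:X_{\mathfrak L_i}\to\mathbb Z_{\ge0}$ ($i=1,2$) be continuous maps such that $$\sigma_{\mathfrak L_2}^{k_1(x)}(h(\sigma_{\mathfrak L_1}(x)))=\sigma_{\mathfrak L_2}^{l_1(x)}(h(x)),\qquad \sigma_{\mathfrak L_1}^{k_2(y)}(h^{-1}(\sigma_{\mathfrak L_2}(y)))=\sigma_{\mathfrak L_1}^{l_2(y)}(h^{-1}(y))$$ for all $x\in X_{\mathfrak L_1}$, $y\in X_{\mathfrak L_2}$. For $f\in C(X_{\mathfrak L_2},\mathbb Z)$ define $\Psi_h(f)\in C(X_{\mathfrak L_1},\mathbb Z)$ by $$\Psi_h(f)(x)=\sum_{i=0}^{l_1(x)}f(\sigma_{\mathfrak L_2}^i(h(x)))-\sum_{j=0}^{k_1(x)}f(\sigma_{\mathfrak L_2}^j(h(\sigma_{\mathfrak L_1}(x)))).$$ Then there is a $*$-isomorphism $\Phi:\mathcal O_{\mathfrak L_1}\to\mathcal O_{\mathfrak L_2}$ such that $\Phi(\mathcal D_{\mathfrak L_1})=\mathcal D_{\mathfrak L_2}$, $\Phi(g)=g\circ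 h^{-1}$ for all $g\in\mathcal D_{\mathfrak L_1}=C(X_{\mathfrak L_1})$, and $$\Phi\circ\rho^{\mathfrak L_1,\Psi_h(f)}_t=\rho^{\mathfrak L_2,f}_t\circ\Phi\qquad\text{for all } f\in C(X_{\mathfrak L_2},\mathbb Z),\ t\in\mathbb R/\mathbb Z.$$ -/

import Mathlib

open Set Topology
open scoped CompactlySupported ENNReal

noncomputable section

/-- The Deaconu--Renault groupoid of `(X, σ)`: all `(x, p - q, z)` with `σ^p x = σ^q z`. -/
def DRGroupoid {X : Type*} (σ : X → X) : Type _ :=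
  {g : X × ℤ × X // ∃ p q : ℕ, (p : ℤ) - q = g.2.1 ∧ σ^[p] g.1 = σ^[q] g.2.2}

namespace DRGroupoid

section Algebra

variable {X : Type*} {σ : X → X}

/-- The range `x` of `(x, n, z)`. -/
def rng (g : DRGroupoid σ) : X := g.1.1

/-- The degree `n` of `(x, n, z)`. -/
def deg (g : DRGroupoid σ) : ℤ := g.1.2.1

/-- The source `z` of `(x, n, z)`. -/
def src (g : DRGroupoid σ) : X := g.1.2.2

theorem ext {g g' : DRGroupoid σ} (h₁ : g.rng = g'.rng) (h₂ : g.deg = g'.deg)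
    (h₃ : g.src = g'.src) : g = g' :=
  Subtype.ext (Prod.ext h₁ (Prod.ext h₂ h₃))

/-- The inverse `(x, n, z)⁻¹ = (z, -n, x)`. -/
def inv (g : DRGroupoid σ) : DRGroupoid σ :=
  ⟨(g.src, -g.deg, g.rng), by
    obtain ⟨p, q, h₁, h₂⟩ := g.2
    exact ⟨q, p, by simp only [deg, ← h₁]; ring, h₂.symm⟩⟩

/-- The product `(x, n, z) (z, m, w) = (x, n + m, w)`. -/
def mul (g k : DRGroupoid σ) (h : g.src = k.rng) : DRGroupoid σ :=
  ⟨(g.rng, g.deg + k.deg, k.src), by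
    obtain ⟨p, q, h₁, h₂⟩ := g.2
    obtain ⟨p', q', h₁', h₂'⟩ := k.2
    refine ⟨p' + p, q + q', ?_, ?_⟩
    · simp only [deg, ← h₁, ← h₁']; push_cast; ring
    · change σ^[p' + p] g.1.1 = σ^[q + q'] k.1.2.2
      have h' : g.1.2.2 = k.1.1 := h
      rw [Function.iterate_add_apply, h₂, Function.iterate_add_apply, ← h₂', ← h',
        ← Function.iterate_add_apply, ← Function.iterate_add_apply, add_comm]⟩

/-- The convolution product `(f * ξ)(t) = ∑_{r(s) = r(t)} f(s) ξ(s⁻¹ t)`. -/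
def conv (f ξ : DRGroupoid σ → ℂ) (t : DRGroupoid σ) : ℂ :=
  ∑' s : {s : DRGroupoid σ // s.rng = t.rng}, f s.1 * ξ (mul (inv s.1) t s.2)

/-- The Birkhoff sum `f^n(x) = ∑_{i < n} f(σ^i x)`. -/
def birkhoff (σ : X → X) (f : X → ℤ) (n : ℕ) (x : X) : ℤ :=
  ∑ i ∈ Finset.range n, f (σ^[i] x)

/-- The cocycle `(x, p - q, z) ↦ f^p(x) - f^q(z)`; see `cocycle_eq` for independence of `p, q`. -/
def cocycle (f : X → ℤ) (g : DRGroupoid σ) : ℤ :=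
  birkhoff σ f g.2.choose g.rng - birkhoff σ f g.2.choose_spec.choose g.src

theorem birkhoff_add (f : X → ℤ) (n m : ℕ) (x : X) :
    birkhoff σ f (n + m) x = birkhoff σ f n x + birkhoff σ f m (σ^[n] x) := by
  simp only [birkhoff, Finset.sum_range_add]
  congr 1
  refine Finset.sum_congr rfl fun i _ => ?_
  rw [add_comm, Function.iterate_add_apply]

theorem birkhoff_sub_eq (f : X → ℤ) {x z : X} {p q p' q' : ℕ} (h : (p : ℤ) - q = p' - q')
    (h₁ : σ^[p] x = σ^[q] z) (h₂ : σ^[p'] x = σ^[q'] z) :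
    birkhoff σ f p x - birkhoff σ f q z = birkhoff σ f p' x - birkhoff σ f q' z := by
  wlog hp : p' ≤ p generalizing p q p' q'
  · exact (this h.symm h₂ h₁ (by omega)).symm
  obtain ⟨d, rfl⟩ := Nat.exists_eq_add_of_le hp
  obtain rfl : q = q' + d := by omega
  rw [birkhoff_add, birkhoff_add, h₂]
  ring

theorem cocycle_eq (f : X → ℤ) (g : DRGroupoid σ) {p q : ℕ} (h : (p : ℤ) - q = g.deg)
    (h' : σ^[p] g.rng = σ^[q] g.src) :
    cocycle f g = birkhoff σ f p g.rng - birkhoff σ f q g.src :=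
  birkhoff_sub_eq f (g.2.choose_spec.choose_spec.1.trans h.symm) g.2.choose_spec.choose_spec.2 h'

theorem cocycle_mul (f : X → ℤ) (g k : DRGroupoid σ) (h : g.src = k.rng) :
    cocycle f (mul g k h) = cocycle f g + cocycle f k := by
  obtain ⟨p, q, h₁, h₂⟩ := g.2
  obtain ⟨p', q', h₁', h₂'⟩ := k.2
  change σ^[p] g.rng = σ^[q] g.src at h₂
  change σ^[p'] k.rng = σ^[q'] k.src at h₂'
  change (p : ℤ) - q = g.deg at h₁
  change (p' : ℤ) - q' = k.deg at h₁'
  have e : σ^[p + p'] g.rng = σ^[q' + q] k.src := by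
    rw [add_comm p, Function.iterate_add_apply, h₂, h, add_comm q', Function.iterate_add_apply,
      ← h₂', ← Function.iterate_add_apply, ← Function.iterate_add_apply, add_comm]
  rw [cocycle_eq f g h₁ h₂, cocycle_eq f k h₁' h₂',
    cocycle_eq f (mul g k h) (p := p + p') (q := q' + q) ?_ e]
  · change birkhoff σ f (p + p') g.rng - birkhoff σ f (q' + q) k.src = _
    rw [birkhoff_add, birkhoff_add, h₂, ← h₂', h]
    have a := birkhoff_add (σ := σ) f q p' k.rng
    have b := birkhoff_add (σ := σ) f p' q k.rng
    rw [add_comm q p'] at a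
    linarith
  · change _ = g.deg + k.deg
    rw [← h₁, ← h₁']; push_cast; ring

theorem cocycle_inv (f : X → ℤ) (g : DRGroupoid σ) : cocycle f (inv g) = -cocycle f g := by
  obtain ⟨p, q, h₁, h₂⟩ := g.2
  rw [cocycle_eq f g h₁ h₂, cocycle_eq f (inv g) (p := q) (q := p) ?_ h₂.symm]
  · change birkhoff σ f q g.src - birkhoff σ f p g.rng = _
    ring
  · change _ = -g.1.2.1
    rw [← h₁]; ring

/-- The element `(x, n, σ^n x)`. -/
def graphPt (σ : X → X) (n : ℕ) (x : X) : DRGroupoid σ :=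
  ⟨(x, n, σ^[n] x), n, 0, by simp, rfl⟩

theorem mem_range_graphPt {n : ℕ} {g : DRGroupoid σ} :
    g ∈ range (graphPt σ n) ↔ g.deg = n ∧ g.src = σ^[n] g.rng := by
  constructor
  · rintro ⟨x, rfl⟩; exact ⟨rfl, rfl⟩
  · rintro ⟨h₁, h₂⟩
    exact ⟨g.rng, ext rfl h₁.symm h₂.symm⟩

end Algebra

section Topology

variable {X : Type*} [TopologicalSpace X] {σ : X → X}

/-- The set of all `(x, p - q, z)` with `x ∈ U`, `z ∈ V` and `σ^p x = σ^q z`. -/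
def basicSet (σ : X → X) (p q : ℕ) (U V : Set X) : Set (DRGroupoid σ) :=
  {g | g.deg = (p : ℤ) - q ∧ g.rng ∈ U ∧ g.src ∈ V ∧ σ^[p] g.rng = σ^[q] g.src}

/-- `U, V` are open and `σ^p`, `σ^q` restrict to homeomorphisms of `U` and of `V` onto the same
open set. -/
structure IsBasic (σ : X → X) (p q : ℕ) (U V : Set X) : Prop where
  openU : IsOpen U
  openV : IsOpen V
  embU : IsOpenEmbedding (U.domRestrict σ^[p])
  embV : IsOpenEmbedding (V.domRestrict σ^[q])
  image_eq : σ^[p] '' U = σ^[q] '' V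

/-- The topology of the groupoid. -/
instance : TopologicalSpace (DRGroupoid σ) :=
  TopologicalSpace.generateFrom {Z | ∃ p q U V, IsBasic σ p q U V ∧ Z = basicSet σ p q U V}

theorem IsBasic.isOpen {p q : ℕ} {U V : Set X} (h : IsBasic σ p q U V) :
    IsOpen (basicSet σ p q U V) :=
  TopologicalSpace.isOpen_generateFrom_of_mem ⟨p, q, U, V, h, rfl⟩

theorem isOpenEmbedding_restrict_mono {Y : Type*} [TopologicalSpace Y] {f : X → Y} {U U' : Set X}
    (h : IsOpenEmbedding (U.domRestrict f)) (hU' : IsOpen U') (hs : U' ⊆ U) :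
    IsOpenEmbedding (U'.domRestrict f) := by
  have : IsOpenEmbedding (Set.inclusion hs) :=
    ⟨IsEmbedding.inclusion hs, by
      rw [Set.range_inclusion]; exact hU'.preimage continuous_subtype_val⟩
  exact h.comp this

theorem isOpen_image_of_restrict {Y : Type*} [TopologicalSpace Y] {f : X → Y} {U U' : Set X}
    (h : IsOpenEmbedding (U.domRestrict f)) (hU' : IsOpen U') (hs : U' ⊆ U) :
    IsOpen (f '' U') := by
  have := (isOpenEmbedding_restrict_mono h hU' hs).isOpen_range
  rwa [Set.range_domRestrict] at this

theorem IsBasic.injU {p q : ℕ} {U V : Set X} (h : IsBasic σ p q U V) : InjOn σ^[p] U :=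
  injOn_iff_injective.2 h.embU.injective

theorem IsBasic.injV {p q : ℕ} {U V : Set X} (h : IsBasic σ p q U V) : InjOn σ^[q] V :=
  injOn_iff_injective.2 h.embV.injective

/-- Shrinking a basic set to an open set of the common range. -/
theorem IsBasic.shrink {p q : ℕ} {U V O : Set X} (hσ : Continuous σ)
    (hU : IsOpen U) (hV : IsOpen V) (eU : IsOpenEmbedding (U.domRestrict σ^[p]))
    (eV : IsOpenEmbedding (V.domRestrict σ^[q])) (hO : IsOpen O)
    (h₁ : O ⊆ σ^[p] '' U) (h₂ : O ⊆ σ^[q] '' V) :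
    IsBasic σ p q (U ∩ σ^[p] ⁻¹' O) (V ∩ σ^[q] ⁻¹' O) := by
  have oU : IsOpen (U ∩ σ^[p] ⁻¹' O) := hU.inter (hO.preimage (hσ.iterate p))
  have oV : IsOpen (V ∩ σ^[q] ⁻¹' O) := hV.inter (hO.preimage (hσ.iterate q))
  refine ⟨oU, oV, isOpenEmbedding_restrict_mono eU oU inter_subset_left,
    isOpenEmbedding_restrict_mono eV oV inter_subset_left, ?_⟩
  rw [image_inter_preimage, image_inter_preimage, inter_eq_right.2 h₁, inter_eq_right.2 h₂]

theorem isLocalHomeomorph_iterate (hσ : IsLocalHomeomorph σ) (n : ℕ) :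
    IsLocalHomeomorph σ^[n] := by
  induction n with
  | zero => exact (Homeomorph.refl X).isLocalHomeomorph
  | succ n ih => rw [Function.iterate_succ]; exact ih.comp hσ

theorem exists_restrict (hσ : IsLocalHomeomorph σ) (n : ℕ) (x : X) :
    ∃ U, IsOpen U ∧ x ∈ U ∧ IsOpenEmbedding (U.domRestrict σ^[n]) := by
  obtain ⟨U, hU, e⟩ := isLocalHomeomorph_iff_isOpenEmbedding_restrict.1
    (isLocalHomeomorph_iterate hσ n) x
  exact ⟨interior U, isOpen_interior, mem_interior_iff_mem_nhds.2 hU,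
    isOpenEmbedding_restrict_mono e isOpen_interior interior_subset⟩

theorem exists_basic (hσ : IsLocalHomeomorph σ) (g : DRGroupoid σ) {p q : ℕ}
    (h : (p : ℤ) - q = g.deg) (h' : σ^[p] g.rng = σ^[q] g.src) {W : Set X} (hW : IsOpen W)
    (hg : g.rng ∈ W) {W' : Set X} (hW' : IsOpen W') (hg' : g.src ∈ W') :
    ∃ U V, IsBasic σ p q U V ∧ U ⊆ W ∧ V ⊆ W' ∧ g ∈ basicSet σ p q U V := by
  obtain ⟨U, hU, xU, eU⟩ := exists_restrict hσ p g.rng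
  obtain ⟨V, hV, zV, eV⟩ := exists_restrict hσ q g.src
  have eU' := isOpenEmbedding_restrict_mono eU (hU.inter hW) inter_subset_left
  have eV' := isOpenEmbedding_restrict_mono eV (hV.inter hW') inter_subset_left
  have oU := isOpen_image_of_restrict eU (hU.inter hW) inter_subset_left
  have oV := isOpen_image_of_restrict eV (hV.inter hW') inter_subset_left
  have m₁ : σ^[p] g.rng ∈ σ^[p] '' (U ∩ W) := mem_image_of_mem _ ⟨xU, hg⟩
  have m₂ : σ^[q] g.src ∈ σ^[q] '' (V ∩ W') := mem_image_of_mem _ ⟨zV, hg'⟩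
  refine ⟨_, _, IsBasic.shrink hσ.continuous (hU.inter hW) (hV.inter hW') eU' eV' (oU.inter oV)
    inter_subset_left inter_subset_right, ?_, ?_, h.symm, ⟨⟨xU, hg⟩, m₁, ?_⟩,
    ⟨⟨zV, hg'⟩, ?_, m₂⟩, h'⟩
  · exact fun a ha => ha.1.2
  · exact fun a ha => ha.1.2
  · rw [h']; exact m₂
  · rw [← h']; exact m₁

theorem exists_basic' (hσ : IsLocalHomeomorph σ) (g : DRGroupoid σ) {W : Set X} (hW : IsOpen W)
    (hg : g.rng ∈ W) {W' : Set X} (hW' : IsOpen W') (hg' : g.src ∈ W') :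
    ∃ p q U V, IsBasic σ p q U V ∧ U ⊆ W ∧ V ⊆ W' ∧ g ∈ basicSet σ p q U V := by
  obtain ⟨p, q, h₁, h₂⟩ := g.2
  exact ⟨p, q, exists_basic hσ g h₁ h₂ hW hg hW' hg'⟩

theorem continuous_rng (hσ : IsLocalHomeomorph σ) : Continuous (rng : DRGroupoid σ → X) := by
  refine continuous_def.2 fun W hW => isOpen_iff_mem_nhds.2 fun g hg => ?_
  obtain ⟨p, q, U, V, hb, hU, -, hg'⟩ := exists_basic' hσ g hW hg isOpen_univ (mem_univ _)
  exact Filter.mem_of_superset (hb.isOpen.mem_nhds hg') fun k hk => hU hk.2.1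

theorem continuous_src (hσ : IsLocalHomeomorph σ) : Continuous (src : DRGroupoid σ → X) := by
  refine continuous_def.2 fun W hW => isOpen_iff_mem_nhds.2 fun g hg => ?_
  obtain ⟨p, q, U, V, hb, -, hV, hg'⟩ := exists_basic' hσ g isOpen_univ (mem_univ _) hW hg
  exact Filter.mem_of_superset (hb.isOpen.mem_nhds hg') fun k hk => hV hk.2.2.1

theorem continuous_deg (hσ : IsLocalHomeomorph σ) : Continuous (deg : DRGroupoid σ → ℤ) := by
  refine continuous_def.2 fun W _ => isOpen_iff_mem_nhds.2 fun g hg => ?_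
  obtain ⟨p, q, U, V, hb, -, -, hg'⟩ :=
    exists_basic' hσ g isOpen_univ (mem_univ _) isOpen_univ (mem_univ _)
  refine Filter.mem_of_superset (hb.isOpen.mem_nhds hg') fun k hk => ?_
  rw [mem_preimage, hk.1, ← hg'.1]
  exact hg

theorem t2Space [T2Space X] (hσ : IsLocalHomeomorph σ) : T2Space (DRGroupoid σ) := by
  refine T2Space.of_injective_continuous (Y := X × ℤ × X)
    (f := fun g : DRGroupoid σ => (g.rng, g.deg, g.src)) (fun g g' h => Subtype.ext h) ?_
  exact (continuous_rng hσ).prodMk ((continuous_deg hσ).prodMk (continuous_src hσ))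

theorem continuous_birkhoff (hσ : Continuous σ) {f : X → ℤ} (hf : Continuous f) (n : ℕ) :
    Continuous (birkhoff σ f n) :=
  continuous_finsetSum _ fun i _ => hf.comp (hσ.iterate i)

theorem continuous_cocycle (hσ : IsLocalHomeomorph σ) {f : X → ℤ} (hf : Continuous f) :
    Continuous (cocycle f : DRGroupoid σ → ℤ) := by
  refine continuous_iff_continuousAt.2 fun g => ?_
  obtain ⟨p, q, U, V, hb, -, -, hg⟩ :=
    exists_basic' hσ g isOpen_univ (mem_univ _) isOpen_univ (mem_univ _)
  have hc : Continuous fun k : DRGroupoid σ => birkhoff σ f p k.rng - birkhoff σ f q k.src :=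
    ((continuous_birkhoff hσ.continuous hf p).comp (continuous_rng hσ)).sub
      ((continuous_birkhoff hσ.continuous hf q).comp (continuous_src hσ))
  refine hc.continuousAt.congr ?_
  filter_upwards [hb.isOpen.mem_nhds hg] with k hk
  exact (cocycle_eq f k hk.1.symm hk.2.2.2).symm

theorem continuous_graphPt (hσ : Continuous σ) (n : ℕ) : Continuous (graphPt σ n) := by
  refine continuous_generateFrom_iff.2 ?_
  rintro _ ⟨p, q, U, V, hb, rfl⟩
  by_cases h : (n : ℤ) = p - q
  · have : graphPt σ n ⁻¹' basicSet σ p q U V = U ∩ σ^[n] ⁻¹' V := by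
      ext x
      constructor
      · rintro ⟨-, h₁, h₂, -⟩; exact ⟨h₁, h₂⟩
      · rintro ⟨h₁, h₂⟩
        refine ⟨h, h₁, h₂, ?_⟩
        obtain rfl : p = q + n := by omega
        exact Function.iterate_add_apply σ q n x
    rw [this]
    exact hb.openU.inter (hb.openV.preimage (hσ.iterate n))
  · have : graphPt σ n ⁻¹' basicSet σ p q U V = ∅ := by
      ext x
      simp only [mem_preimage, mem_empty_iff_false, iff_false]
      rintro ⟨h₁, -⟩
      exact h h₁
    rw [this]
    exact isOpen_empty

theorem isOpen_range_graphPt (hσ : IsLocalHomeomorph σ) (n : ℕ) :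
    IsOpen (range (graphPt σ n)) := by
  refine isOpen_iff_mem_nhds.2 fun g hg => ?_
  obtain ⟨h₁, h₂⟩ := mem_range_graphPt.1 hg
  obtain ⟨U, V, hb, -, -, hg'⟩ := exists_basic hσ g (p := n) (q := 0) (by simp [h₁])
    (by rw [h₂]; rfl) isOpen_univ (mem_univ _) isOpen_univ (mem_univ _)
  refine Filter.mem_of_superset (hb.isOpen.mem_nhds hg') fun k hk => ?_
  exact mem_range_graphPt.2 ⟨by simpa using hk.1, by simpa using hk.2.2.2.symm⟩

open Classical in
/-- For continuous `a` on `X`, the function on the groupoid with value `a x` at `(x, n, σ^n x)`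
and `0` at all other elements. For `n = 0` this extends a function on the unit space by zero. -/
def graphFun [CompactSpace X] [T2Space X] (hσ : IsLocalHomeomorph σ) (n : ℕ) (a : C(X, ℂ)) :
    C_c(DRGroupoid σ, ℂ) where
  toFun g := if g.deg = n ∧ g.src = σ^[n] g.rng then a g.rng else 0
  continuous_toFun := by
    have := t2Space hσ
    have hc : IsClopen {g : DRGroupoid σ | g.deg = n ∧ g.src = σ^[n] g.rng} := by
      have : {g : DRGroupoid σ | g.deg = n ∧ g.src = σ^[n] g.rng} = range (graphPt σ n) :=
        Set.ext fun g => mem_range_graphPt.symm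
      rw [this]
      exact ⟨(isCompact_range (continuous_graphPt hσ.continuous n)).isClosed,
        isOpen_range_graphPt hσ n⟩
    refine Continuous.if ?_ (a.continuous.comp (continuous_rng hσ)) continuous_const
    intro g hg
    rw [hc.frontier_eq] at hg
    exact hg.elim
  hasCompactSupport' := by
    have := t2Space hσ
    refine HasCompactSupport.intro (isCompact_range (continuous_graphPt hσ.continuous n)) ?_
    intro g hg
    exact if_neg fun h => hg (mem_range_graphPt.2 h)

end Topology

section Representation

variable {X : Type*} {σ : X → X}

/-- The Hilbert space of square summable functions on the groupoid; it is the orthogonal sum of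
the spaces `ℓ²(s⁻¹(z))`, `z ∈ X`. -/
abbrev Hilb (σ : X → X) : Type _ := lp (fun _ : DRGroupoid σ => ℂ) 2

theorem conv_eq_sum (f ξ : DRGroupoid σ → ℂ) (t : DRGroupoid σ)
    (F : Finset {s : DRGroupoid σ // s.rng = t.rng}) (hF : ∀ s, s ∉ F → f s.1 = 0) :
    conv f ξ t = ∑ s ∈ F, f s.1 * ξ (mul (inv s.1) t s.2) :=
  tsum_eq_sum fun s hs => by rw [hF s hs, zero_mul]

theorem exists_convOp (f : DRGroupoid σ → ℂ) (K : ℕ) (M : ℝ) (hM : ∀ g, ‖f g‖ ≤ M)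
    (hr : ∀ x, {s | s.rng = x ∧ f s ≠ 0}.encard ≤ K)
    (hs : ∀ x, {s | s.src = x ∧ f s ≠ 0}.encard ≤ K) :
    ∃ T : Hilb σ →L[ℂ] Hilb σ, ∀ (ξ : Hilb σ) (t : DRGroupoid σ), T ξ t = conv f ξ t := by
  classical
  have hfin : ∀ t : DRGroupoid σ, {s : {s : DRGroupoid σ // s.rng = t.rng} | f s.1 ≠ 0}.Finite := by
    intro t
    have h₁ : {s | s.rng = t.rng ∧ f s ≠ 0}.Finite := finite_of_encard_le_coe (hr _)
    refine Set.Finite.of_finite_image (f := Subtype.val) (h₁.subset ?_) Subtype.val_injective.injOn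
    rintro _ ⟨s, h, rfl⟩
    exact ⟨s.2, h⟩
  let F : ∀ t : DRGroupoid σ, Finset {s : DRGroupoid σ // s.rng = t.rng} :=
    fun t => (hfin t).toFinset
  have hF : ∀ t s, s ∈ F t ↔ f s.1 ≠ 0 := fun t s => by simp [F]
  have hconv : ∀ (ξ : DRGroupoid σ → ℂ) t,
      conv f ξ t = ∑ s ∈ F t, f s.1 * ξ (mul (inv s.1) t s.2) := fun ξ t =>
    conv_eq_sum f ξ t (F t) fun s h => by
      by_contra h'
      exact h ((hF t s).2 h')
  have hcard : ∀ t, ((F t).card : ℝ) ≤ K := by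
    intro t
    have h₁ : (F t).card = ((F t).image Subtype.val).card :=
      (Finset.card_image_of_injective _ Subtype.val_injective).symm
    have h₂ : (((F t).image Subtype.val : Finset (DRGroupoid σ)) : Set (DRGroupoid σ)).encard ≤ K := by
      refine (encard_le_encard ?_).trans (hr t.rng)
      intro s hs'
      simp only [Finset.coe_image, mem_image, Finset.mem_coe] at hs'
      obtain ⟨s', h, rfl⟩ := hs'
      exact ⟨s'.2, (hF t s').1 h⟩
    rw [encard_coe_eq_coe_finsetCard] at h₂
    rw [h₁]
    exact_mod_cast h₂
  have key : ∀ (ξ : Hilb σ) (A : Finset (DRGroupoid σ)),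
      ∑ t ∈ A, ‖conv f ξ t‖ ^ 2 ≤ (K * M * ‖ξ‖) ^ 2 := by
    intro ξ A
    have step : ∀ t, ‖conv f ξ t‖ ^ 2 ≤
        K * M ^ 2 * ∑ s ∈ F t, ‖ξ (mul (inv s.1) t s.2)‖ ^ 2 := by
      intro t
      have a₁ : ‖conv f ξ t‖ ≤ ∑ s ∈ F t, M * ‖ξ (mul (inv s.1) t s.2)‖ := by
        rw [hconv]
        refine (norm_sum_le _ _).trans (Finset.sum_le_sum fun s _ => ?_)
        rw [norm_mul]
        exact mul_le_mul_of_nonneg_right (hM _) (norm_nonneg _)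
      calc ‖conv f ξ t‖ ^ 2 ≤ (∑ s ∈ F t, M * ‖ξ (mul (inv s.1) t s.2)‖) ^ 2 := by gcongr
        _ ≤ (F t).card * ∑ s ∈ F t, (M * ‖ξ (mul (inv s.1) t s.2)‖) ^ 2 :=
            sq_sum_le_card_mul_sum_sq
        _ ≤ K * ∑ s ∈ F t, (M * ‖ξ (mul (inv s.1) t s.2)‖) ^ 2 := by
            exact mul_le_mul_of_nonneg_right (hcard t) (by positivity)
        _ = _ := by simp only [mul_pow, ← Finset.mul_sum]; ring
    have a₂ : ∑ t ∈ A, ∑ s ∈ F t, ‖ξ (mul (inv s.1) t s.2)‖ ^ 2 ≤ K * ‖ξ‖ ^ 2 := by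
      rw [Finset.sum_sigma' A F
        (fun t (s : {s : DRGroupoid σ // s.rng = t.rng}) => ‖ξ (mul (inv s.1) t s.2)‖ ^ 2)]
      let φ : (Σ t : DRGroupoid σ, {s : DRGroupoid σ // s.rng = t.rng}) → DRGroupoid σ :=
        fun a => mul (inv a.2.1) a.1 a.2.2
      have a₃ := Finset.sum_comp (s := A.sigma F) (fun u => ‖ξ u‖ ^ 2) φ
      refine a₃.le.trans ?_
      have a₄ : ∀ u ∈ (A.sigma F).image φ,
          ((A.sigma F).filter (fun a => φ a = u)).card • ‖ξ u‖ ^ 2 ≤ K * ‖ξ u‖ ^ 2 := by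
        intro u _
        rw [nsmul_eq_mul]
        refine mul_le_mul_of_nonneg_right ?_ (by positivity)
        have b₁ : ((A.sigma F).filter (fun a => φ a = u)).card =
            (((A.sigma F).filter (fun a => φ a = u)).image (fun a => a.2.1)).card := by
          refine (Finset.card_image_of_injOn ?_).symm
          rintro ⟨t, s, h⟩ ha ⟨t', s', h'⟩ ha' (rfl : s = s')
          have e : φ ⟨t, s, h⟩ = φ ⟨t', s, h'⟩ :=
            (Finset.mem_filter.1 (Finset.mem_coe.1 ha)).2.trans
              (Finset.mem_filter.1 (Finset.mem_coe.1 ha')).2.symm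
          have e₂ : t.deg = t'.deg := by
            have : -s.deg + t.deg = -s.deg + t'.deg := congrArg deg e
            linarith
          have e₃ : (φ ⟨t, s, h⟩).src = (φ ⟨t', s, h'⟩).src := by rw [e]
          obtain rfl : t = t' := ext (h.symm.trans h') e₂ e₃
          rfl
        have b₂ : ((((A.sigma F).filter (fun a => φ a = u)).image (fun a => a.2.1) :
            Finset (DRGroupoid σ)) : Set (DRGroupoid σ)).encard ≤ K := by
          refine (encard_le_encard ?_).trans (hs u.rng)
          intro s hs'
          simp only [Finset.coe_image, mem_image, Finset.mem_coe, Finset.mem_filter,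
            Finset.mem_sigma] at hs'
          obtain ⟨a, ⟨⟨-, h₂⟩, h₃⟩, rfl⟩ := hs'
          exact ⟨congrArg rng h₃, (hF _ _).1 h₂⟩
        rw [encard_coe_eq_coe_finsetCard] at b₂
        rw [b₁]
        exact_mod_cast b₂
      refine (Finset.sum_le_sum a₄).trans ?_
      rw [← Finset.mul_sum]
      refine mul_le_mul_of_nonneg_left ?_ (by positivity)
      have := lp.sum_rpow_le_norm_rpow (p := 2) (by norm_num) ξ ((A.sigma F).image φ)
      simpa using this
    calc ∑ t ∈ A, ‖conv f ξ t‖ ^ 2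
        ≤ ∑ t ∈ A, K * M ^ 2 * ∑ s ∈ F t, ‖ξ (mul (inv s.1) t s.2)‖ ^ 2 :=
          Finset.sum_le_sum fun t _ => step t
      _ = K * M ^ 2 * ∑ t ∈ A, ∑ s ∈ F t, ‖ξ (mul (inv s.1) t s.2)‖ ^ 2 := by
          rw [Finset.mul_sum]
      _ ≤ K * M ^ 2 * (K * ‖ξ‖ ^ 2) := by gcongr
      _ = _ := by ring
  have hmem : ∀ ξ : Hilb σ, Memℓp (conv f ξ) 2 := fun ξ =>
    memℓp_gen' (C := (K * M * ‖ξ‖) ^ 2) fun A => by simpa using key ξ A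
  let T₀ : Hilb σ →ₗ[ℂ] Hilb σ :=
    { toFun := fun ξ => ⟨conv f ξ, hmem ξ⟩
      map_add' := fun ξ η => by
        apply lp.ext
        funext t
        change conv f ((ξ : Hilb σ) + η : Hilb σ) t = conv f ξ t + conv f η t
        rw [hconv, hconv, hconv, ← Finset.sum_add_distrib]
        refine Finset.sum_congr rfl fun s _ => ?_
        rw [lp.coeFn_add, Pi.add_apply, mul_add]
      map_smul' := fun c ξ => by
        apply lp.ext
        funext t
        change conv f (c • ξ : Hilb σ) t = c * conv f ξ t
        rw [hconv, hconv, Finset.mul_sum]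
        refine Finset.sum_congr rfl fun s _ => ?_
        rw [lp.coeFn_smul, Pi.smul_apply, smul_eq_mul]
        ring }
  refine ⟨T₀.mkContinuous (K * |M|) fun ξ => ?_, fun ξ t => rfl⟩
  refine lp.norm_le_of_forall_sum_le (p := 2) (by norm_num) (by positivity) fun A => ?_
  have h := key ξ A
  have e : (K * M * ‖ξ‖) ^ 2 = (K * |M| * ‖ξ‖) ^ 2 := by
    rw [mul_pow, mul_pow, mul_pow, mul_pow, sq_abs]
  rw [e] at h
  simpa [T₀] using h

/-- The diagonal unitary `(U ξ)(g) = u(g) ξ(g)` on `ℓ²(G)`. -/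
def diagUnitary (u : DRGroupoid σ → Circle) : Hilb σ ≃ₗᵢ[ℂ] Hilb σ where
  toFun ξ := ⟨fun g => (u g : ℂ) * ξ g, (lp.memℓp ξ).mono' fun g => by simp [Circle.norm_coe]⟩
  invFun ξ := ⟨fun g => ((u g)⁻¹ : Circle) * ξ g, (lp.memℓp ξ).mono' fun g => by simp [Circle.norm_coe]⟩
  map_add' ξ η := by
    apply lp.ext
    funext g
    exact mul_add _ _ _
  map_smul' c ξ := by
    apply lp.ext
    funext g
    exact mul_left_comm _ _ _
  left_inv ξ := by
    apply lp.ext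
    funext g
    change (((u g)⁻¹ : Circle) : ℂ) * ((u g : ℂ) * ξ g) = ξ g
    rw [← mul_assoc, ← Circle.coe_mul, inv_mul_cancel, Circle.coe_one, one_mul]
  right_inv ξ := by
    apply lp.ext
    funext g
    change (u g : ℂ) * ((((u g)⁻¹ : Circle) : ℂ) * ξ g) = ξ g
    rw [← mul_assoc, ← Circle.coe_mul, mul_inv_cancel, Circle.coe_one, one_mul]
  norm_map' ξ := by
    apply le_antisymm
    · exact lp.norm_mono (by norm_num) fun g => by simp [Circle.norm_coe]
    · exact lp.norm_mono (by norm_num) fun g => by simp [Circle.norm_coe]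

theorem diagUnitary_apply (u : DRGroupoid σ → Circle) (ξ : Hilb σ) (g : DRGroupoid σ) :
    diagUnitary u ξ g = (u g : ℂ) * ξ g := rfl

theorem diagUnitary_symm (u : DRGroupoid σ → Circle) :
    (diagUnitary u).symm = diagUnitary (fun g => (u g)⁻¹) :=
  LinearIsometryEquiv.ext fun _ => rfl

/-- The unitary `(U_t(f) ξ)(g) = exp(2 π i t f_G(g)) ξ(g)` on `ℓ²(G)`, where `f_G` is the cocycle
of `f` and `t ∈ ℝ/ℤ`. -/
def gaugeUnitary (f : X → ℤ) (t : UnitAddCircle) : Hilb σ ≃ₗᵢ[ℂ] Hilb σ :=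
  diagUnitary fun g => AddCircle.toCircle (cocycle f g • t)

theorem gaugeUnitary_symm (f : X → ℤ) (t : UnitAddCircle) :
    (gaugeUnitary f t : Hilb σ ≃ₗᵢ[ℂ] Hilb σ).symm = gaugeUnitary f (-t) := by
  simp only [gaugeUnitary, diagUnitary_symm, smul_neg, AddCircle.toCircle_neg]

variable [TopologicalSpace X]

theorem exists_convOp_of_compactSupport (hσ : IsLocalHomeomorph σ) (f : C_c(DRGroupoid σ, ℂ)) :
    ∃ T : Hilb σ →L[ℂ] Hilb σ, ∀ (ξ : Hilb σ) (t : DRGroupoid σ), T ξ t = conv f ξ t := by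
  classical
  have hK : IsCompact (tsupport f) := f.hasCompactSupport
  obtain ⟨M, hM⟩ : ∃ M, ∀ g, ‖f g‖ ≤ M := f.hasCompactSupport.exists_bound_of_continuous f.continuous
  have hb : ∀ g : DRGroupoid σ, ∃ Z : Set (DRGroupoid σ), IsOpen Z ∧ g ∈ Z ∧
      InjOn rng Z ∧ InjOn src Z := by
    intro g
    obtain ⟨p, q, U, V, hb, -, -, hg⟩ :=
      exists_basic' hσ g isOpen_univ (mem_univ _) isOpen_univ (mem_univ _)
    refine ⟨_, hb.isOpen, hg, ?_, ?_⟩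
    · intro a ha b hb' h
      refine ext h (ha.1.trans hb'.1.symm) (hb.injV ha.2.2.1 hb'.2.2.1 ?_)
      rw [← ha.2.2.2, ← hb'.2.2.2, h]
    · intro a ha b hb' h
      refine ext (hb.injU ha.2.1 hb'.2.1 ?_) (ha.1.trans hb'.1.symm) h
      rw [ha.2.2.2, hb'.2.2.2, h]
  choose Z hZo hZm hZr hZs using hb
  obtain ⟨A, hA⟩ := hK.elim_finite_subcover Z hZo fun g _ => mem_iUnion.2 ⟨g, hZm g⟩
  have cover : ∀ s, f s ≠ 0 → ∃ a ∈ A, s ∈ Z a := fun s hs => by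
    have := hA (subset_tsupport f hs)
    simpa using this
  have count : ∀ (π : DRGroupoid σ → X), (∀ a, InjOn π (Z a)) → ∀ x,
      {s | π s = x ∧ f s ≠ 0}.encard ≤ A.card := by
    intro π hπ x
    rw [← encard_coe_eq_coe_finsetCard]
    have cover' : ∀ s, ∃ a, f s ≠ 0 → a ∈ A ∧ s ∈ Z a := fun s => by
      by_cases h : f s = 0
      · exact ⟨s, fun h' => (h' h).elim⟩
      · obtain ⟨a, ha⟩ := cover s h
        exact ⟨a, fun _ => ha⟩
    choose c hc using cover'
    refine encard_le_encard_of_injOn (f := c) (fun s hs => (hc s hs.2).1) ?_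
    intro s hs s' hs' h
    refine hπ (c s) (hc s hs.2).2 ?_ (hs.1.trans hs'.1.symm)
    rw [h]
    exact (hc s' hs'.2).2
  exact exists_convOp f A.card M hM (count rng hZr) (count src hZs)

/-- The left regular representation `π(f) ξ = f * ξ` of `C_c(G)` on `ℓ²(G)`. -/
def regRep (hσ : IsLocalHomeomorph σ) (f : C_c(DRGroupoid σ, ℂ)) : Hilb σ →L[ℂ] Hilb σ :=
  (exists_convOp_of_compactSupport hσ f).choose

theorem regRep_apply (hσ : IsLocalHomeomorph σ) (f : C_c(DRGroupoid σ, ℂ)) (ξ : Hilb σ)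
    (t : DRGroupoid σ) : regRep hσ f ξ t = conv f ξ t :=
  (exists_convOp_of_compactSupport hσ f).choose_spec ξ t

/-- The reduced groupoid C*-algebra: the C*-subalgebra of the bounded operators on `ℓ²(G)`
generated by the image of `C_c(G)` under the left regular representation. -/
def redAlg (hσ : IsLocalHomeomorph σ) : StarSubalgebra ℂ (Hilb σ →L[ℂ] Hilb σ) :=
  (StarAlgebra.adjoin ℂ (range (regRep hσ))).topologicalClosure

theorem regRep_mem (hσ : IsLocalHomeomorph σ) (f : C_c(DRGroupoid σ, ℂ)) :
    regRep hσ f ∈ redAlg hσ :=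
  StarSubalgebra.le_topologicalClosure _ (StarAlgebra.subset_adjoin ℂ _ ⟨f, rfl⟩)

theorem gauge_regRep (hσ : IsLocalHomeomorph σ) {f : X → ℤ} (hf : Continuous f)
    (t : UnitAddCircle) (a : C_c(DRGroupoid σ, ℂ)) :
    ∃ b, (gaugeUnitary f t).conjStarAlgEquiv (regRep hσ a) = regRep hσ b := by
  let b : C_c(DRGroupoid σ, ℂ) :=
    { toFun := fun g => (AddCircle.toCircle (cocycle f g • t) : ℂ) * a g
      continuous_toFun := by
        refine Continuous.mul ?_ a.continuous
        have h : Continuous fun n : ℤ => (AddCircle.toCircle (n • t) : ℂ) :=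
          continuous_of_discreteTopology
        exact h.comp (continuous_cocycle hσ hf)
      hasCompactSupport' := a.hasCompactSupport.mul_left }
  refine ⟨b, ?_⟩
  ext ξ k
  rw [regRep_apply]
  change (gaugeUnitary f t) (regRep hσ a ((gaugeUnitary f t).symm ξ)) k = _
  rw [gaugeUnitary_symm, gaugeUnitary, diagUnitary_apply, regRep_apply, conv, conv,
    ← tsum_mul_left]
  refine tsum_congr fun s => ?_
  have hm : cocycle f (mul (inv s.1) k s.2) = -cocycle f s.1 + cocycle f k := by
    rw [← cocycle_inv]
    exact cocycle_mul f (inv s.1) k s.2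
  rw [gaugeUnitary, diagUnitary_apply, hm]
  change _ = (AddCircle.toCircle (cocycle f s.1 • t) : ℂ) * a s.1 * _
  have e : AddCircle.toCircle (cocycle f k • t) *
      AddCircle.toCircle ((-cocycle f s.1 + cocycle f k) • -t) =
      AddCircle.toCircle (cocycle f s.1 • t) := by
    rw [← AddCircle.toCircle_add]
    congr 1
    module
  rw [← e, Circle.coe_mul]
  ring

theorem gauge_mem (hσ : IsLocalHomeomorph σ) {f : X → ℤ} (hf : Continuous f) (t : UnitAddCircle)
    {T : Hilb σ →L[ℂ] Hilb σ} (hT : T ∈ redAlg hσ) :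
    (gaugeUnitary f t).conjStarAlgEquiv T ∈ redAlg hσ := by
  have hc : Continuous (gaugeUnitary f t : Hilb σ ≃ₗᵢ[ℂ] Hilb σ).conjStarAlgEquiv :=
    (gaugeUnitary f t : Hilb σ ≃ₗᵢ[ℂ] Hilb σ).toContinuousLinearEquiv.conjContinuousAlgEquiv.continuous
  refine map_mem_closure hc hT fun S hS => ?_
  have hle : StarAlgebra.adjoin ℂ (range (regRep hσ)) ≤
      (StarAlgebra.adjoin ℂ (range (regRep hσ))).comap
        ((gaugeUnitary f t : Hilb σ ≃ₗᵢ[ℂ] Hilb σ).conjStarAlgEquiv :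
          (Hilb σ →L[ℂ] Hilb σ) →⋆ₐ[ℂ] (Hilb σ →L[ℂ] Hilb σ)) := by
    refine StarAlgebra.adjoin_le ?_
    rintro _ ⟨a, rfl⟩
    obtain ⟨b, hb⟩ := gauge_regRep hσ hf t a
    exact StarAlgebra.subset_adjoin ℂ _ ⟨b, hb.symm⟩
  exact hle hS

/-- The gauge action with potential `f`: the automorphism `Ad(U_t(f))` of the reduced groupoid
C*-algebra. -/
def gaugeAut (hσ : IsLocalHomeomorph σ) (f : C(X, ℤ)) (t : UnitAddCircle) :
    redAlg hσ ≃⋆ₐ[ℂ] redAlg hσ where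
  toFun T := ⟨(gaugeUnitary f t).conjStarAlgEquiv T, gauge_mem hσ f.continuous t T.2⟩
  invFun T := ⟨(gaugeUnitary f t).symm.conjStarAlgEquiv T, by
    rw [gaugeUnitary_symm]; exact gauge_mem hσ f.continuous (-t) T.2⟩
  left_inv T := Subtype.ext ((gaugeUnitary f t).conjStarAlgEquiv.symm_apply_apply T.1)
  right_inv T := Subtype.ext ((gaugeUnitary f t).conjStarAlgEquiv.apply_symm_apply T.1)
  map_mul' S T := Subtype.ext (map_mul _ S.1 T.1)
  map_add' S T := Subtype.ext (map_add _ S.1 T.1)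
  map_star' T := Subtype.ext (map_star _ T.1)
  map_smul' c T := Subtype.ext (map_smul _ c T.1)

end Representation

end DRGroupoid

/-- A `λ`-graph system over the alphabet `Fin N`: a labeled Bratteli diagram with finite vertex
sets `V l` and finite edge sets `E l` (edges from level `l` to level `l + 1`), together with
surjections `ι : V (l + 1) → V l` satisfying the local property. -/
structure LambdaGraphSystem (N : ℕ) where
  /-- vertices at level `l` -/
  V : ℕ → Type*
  /-- edges from level `l` to level `l + 1` -/
  E : ℕ → Type*
  finite_V : ∀ l, Finite (V l)
  finite_E : ∀ l, Finite (E l)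
  /-- source of an edge -/
  src : ∀ {l}, E l → V l
  /-- terminal of an edge -/
  tgt : ∀ {l}, E l → V (l + 1)
  /-- label of an edge -/
  lab : ∀ {l}, E l → Fin N
  /-- the shift operation -/
  ι : ∀ {l}, V (l + 1) → V l
  ι_surjective : ∀ l, Function.Surjective (ι (l := l))
  exists_src : ∀ {l} (v : V l), ∃ e : E l, src e = v
  exists_tgt : ∀ {l} (v : V (l + 1)), ∃ e : E l, tgt e = v
  local_property : ∀ {l} (u : V l) (v : V (l + 2)),
    ∃ φ : {e : E (l + 1) // ι (src e) = u ∧ tgt e = v} ≃ {e : E l // src e = u ∧ tgt e = ι v},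
      ∀ e, lab (φ e).1 = lab e.1

namespace LambdaGraphSystem

open DRGroupoid

variable {N : ℕ} (L : LambdaGraphSystem N)

instance (l : ℕ) : Finite (L.V l) := L.finite_V l

/-- The vertex sets carry the discrete topology. -/
instance (l : ℕ) : TopologicalSpace (L.V l) := ⊥

instance (l : ℕ) : DiscreteTopology (L.V l) := ⟨rfl⟩

/-- An edge is determined by its label and its terminal. -/
def LeftResolving : Prop :=
  ∀ (l : ℕ) (e f : L.E l), L.lab e = L.lab f → L.tgt e = L.tgt f → e = f

/-- The label sequences of the infinite paths that leave the vertex `v`. -/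
def followers {l : ℕ} (v : L.V l) : Set (ℕ → Fin N) :=
  {a | ∃ e : ∀ n, L.E (l + n), L.src (e 0) = v ∧ (∀ n, L.tgt (e n) = L.src (e (n + 1))) ∧
    ∀ n, L.lab (e n) = a n}

/-- Condition (I): at least two distinct infinite label sequences leave each vertex. -/
def ConditionI : Prop :=
  ∀ (l : ℕ) (v : L.V l), (L.followers v).Nontrivial

/-- The admissible words of the presented subshift: the label sequences of finite paths. (Every
finite path extends to an infinite one, since every vertex emits an edge.) -/
def IsAdmissible (μ : List (Fin N)) : Prop :=
  ∃ (l : ℕ) (v : L.V l), ∃ a ∈ L.followers v, μ = (List.range μ.length).map a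

/-- The projective limit of the vertex sets along `ι`. -/
def Om : Type _ := {v : ∀ l, L.V l // ∀ l, L.ι (v (l + 1)) = v l}

instance : TopologicalSpace L.Om := inferInstanceAs (TopologicalSpace (Subtype _))

instance : T2Space L.Om := inferInstanceAs (T2Space (Subtype _))

theorem continuous_coord (l : ℕ) : Continuous fun v : L.Om => v.1 l :=
  (continuous_apply l).comp continuous_subtype_val

instance : CompactSpace L.Om := by
  have h : IsClosed {v : ∀ l, L.V l | ∀ l, L.ι (v (l + 1)) = v l} := by
    rw [ofPred_forall]
    refine isClosed_iInter fun l => isClosed_eq ?_ (continuous_apply l)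
    exact continuous_of_discreteTopology.comp (continuous_apply (l + 1))
  have e : IsClosedEmbedding (Subtype.val : L.Om → ∀ l, L.V l) :=
    ⟨IsEmbedding.subtypeVal, by rw [Subtype.range_coe_subtype]; exact h⟩
  exact e.compactSpace

/-- The edges `(u, α, v)` of the continuous graph on the projective limit. -/
def IsEdge (u : L.Om) (α : Fin N) (v : L.Om) : Prop :=
  ∃ e : ∀ l, L.E l, ∀ l, L.src (e l) = u.1 l ∧ L.tgt (e l) = v.1 (l + 1) ∧ L.lab (e l) = α

theorem isEdge_iff {u : L.Om} {α : Fin N} {v : L.Om} : L.IsEdge u α v ↔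
    ∀ l, ∃ e : L.E l, L.src e = u.1 l ∧ L.tgt e = v.1 (l + 1) ∧ L.lab e = α :=
  (Classical.skolem (p := fun l (e : L.E l) =>
    L.src e = u.1 l ∧ L.tgt e = v.1 (l + 1) ∧ L.lab e = α)).symm

theorem isClosed_isEdge : IsClosed {w : L.Om × Fin N × L.Om | L.IsEdge w.1 w.2.1 w.2.2} := by
  simp only [isEdge_iff, ofPred_forall]
  refine isClosed_iInter fun l => ?_
  have hc : Continuous fun w : L.Om × Fin N × L.Om => (w.1.1 l, w.2.1, w.2.2.1 (l + 1)) :=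
    ((L.continuous_coord l).comp continuous_fst).prodMk
      (continuous_snd.fst.prodMk ((L.continuous_coord (l + 1)).comp continuous_snd.snd))
  exact (isClosed_discrete {c : L.V l × Fin N × L.V (l + 1) |
    ∃ e : L.E l, L.src e = c.1 ∧ L.tgt e = c.2.2 ∧ L.lab e = c.2.1}).preimage hc

/-- The one-sided paths `(α_i, v_i)_{i ≥ 1}` of the continuous graph; the `i`-th entry is stored at
the index `i - 1`. -/
def XSp : Type _ := {x : ℕ → Fin N × L.Om //
  (∀ i, L.IsEdge (x i).2 (x (i + 1)).1 (x (i + 1)).2) ∧ ∃ v₀, L.IsEdge v₀ (x 0).1 (x 0).2}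

instance : TopologicalSpace L.XSp := inferInstanceAs (TopologicalSpace (Subtype _))

instance : T2Space L.XSp := inferInstanceAs (T2Space (Subtype _))

instance : CompactSpace L.XSp := by
  have h₁ : IsClosed {x : ℕ → Fin N × L.Om | ∀ i, L.IsEdge (x i).2 (x (i + 1)).1 (x (i + 1)).2} := by
    rw [ofPred_forall]
    refine isClosed_iInter fun i => ?_
    refine L.isClosed_isEdge.preimage (f := fun x : ℕ → Fin N × L.Om =>
      ((x i).2, (x (i + 1)).1, (x (i + 1)).2)) ?_
    fun_prop
  have h₂ : IsClosed {x : ℕ → Fin N × L.Om | ∃ v₀, L.IsEdge v₀ (x 0).1 (x 0).2} := by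
    have h : IsClosed {w : L.Om × (ℕ → Fin N × L.Om) | L.IsEdge w.1 (w.2 0).1 (w.2 0).2} := by
      refine L.isClosed_isEdge.preimage (f := fun w : L.Om × (ℕ → Fin N × L.Om) =>
        (w.1, (w.2 0).1, (w.2 0).2)) ?_
      fun_prop
    have h' := isClosedMap_snd_of_compactSpace _ h
    convert h' using 1
    ext x
    constructor
    · rintro ⟨v, hv⟩; exact ⟨(v, x), hv, rfl⟩
    · rintro ⟨⟨v, _⟩, hv, rfl⟩; exact ⟨v, hv⟩
  have e : IsClosedEmbedding (Subtype.val : L.XSp → ℕ → Fin N × L.Om) :=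
    ⟨IsEmbedding.subtypeVal, by rw [Subtype.range_coe_subtype]; exact h₁.inter h₂⟩
  exact e.compactSpace

/-- The shift map on one-sided paths. -/
def shift (x : L.XSp) : L.XSp :=
  ⟨fun i => x.1 (i + 1), fun i => x.2.1 (i + 1), (x.1 0).2, x.2.1 0⟩

theorem continuous_entry (i : ℕ) : Continuous fun x : L.XSp => x.1 i :=
  (continuous_apply i).comp continuous_subtype_val

theorem continuous_shift : Continuous L.shift :=
  Continuous.subtype_mk (continuous_pi fun i => L.continuous_entry (i + 1))
    fun x => (L.shift x).2

/-- The first label `λ_1(x)`. -/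
def firstLabel (x : L.XSp) : Fin N := (x.1 0).1

/-- A vertex `v(x)_0` from which the path `x` starts; it is unique for left-resolving systems. -/
def initVertex (x : L.XSp) : L.Om := x.2.2.choose

theorem initVertex_spec (x : L.XSp) : L.IsEdge (L.initVertex x) (x.1 0).1 (x.1 0).2 :=
  x.2.2.choose_spec

theorem continuous_firstLabel : Continuous L.firstLabel := continuous_fst.comp (L.continuous_entry 0)

variable {L}

theorem LeftResolving.src_unique (hL : L.LeftResolving) {u u' v : L.Om} {α : Fin N}
    (h : L.IsEdge u α v) (h' : L.IsEdge u' α v) : u = u' := by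
  obtain ⟨e, he⟩ := h
  obtain ⟨e', he'⟩ := h'
  refine Subtype.ext (funext fun l => ?_)
  rw [← (he l).1, ← (he' l).1,
    hL l (e l) (e' l) ((he l).2.2.trans (he' l).2.2.symm) ((he l).2.1.trans (he' l).2.1.symm)]

theorem LeftResolving.exists_edge (hL : L.LeftResolving) (v : L.Om) (e₀ : L.E 0)
    (h₀ : L.tgt e₀ = v.1 1) : ∃ u, L.IsEdge u (L.lab e₀) v := by
  have ex : ∀ l, ∃ e : L.E l, L.tgt e = v.1 (l + 1) ∧ L.lab e = L.lab e₀ := by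
    intro l
    induction l with
    | zero => exact ⟨e₀, h₀, rfl⟩
    | succ l ih =>
      obtain ⟨e, he, hl⟩ := ih
      obtain ⟨φ, hφ⟩ := L.local_property (L.src e) (v.1 (l + 2))
      let e' := φ.symm ⟨e, rfl, he.trans (v.2 (l + 1)).symm⟩
      refine ⟨e'.1, e'.2.2, ?_⟩
      rw [← hφ e', Equiv.apply_symm_apply]
      exact hl
  choose e he hl using ex
  refine ⟨⟨fun l => L.src (e l), fun l => ?_⟩, e, fun l => ⟨rfl, he l, hl l⟩⟩
  obtain ⟨φ, hφ⟩ := L.local_property (L.ι (L.src (e (l + 1)))) (v.1 (l + 2))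
  let e' := φ ⟨e (l + 1), rfl, he (l + 1)⟩
  have h₁ : e'.1 = e l := by
    refine hL l _ _ ?_ ?_
    · rw [hφ, hl, hl]
    · rw [e'.2.2, he]
      exact v.2 (l + 1)
  exact e'.2.1.symm.trans (by rw [h₁])

theorem LeftResolving.isLocalHomeomorph_shift (hL : L.LeftResolving) :
    IsLocalHomeomorph L.shift := by
  refine isLocalHomeomorph_iff_isOpenEmbedding_restrict.2 fun x => ?_
  have hclopen : IsClopen {y : L.XSp | L.firstLabel y = L.firstLabel x} :=
    (isClopen_discrete {L.firstLabel x}).preimage L.continuous_firstLabel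
  refine ⟨{y | L.firstLabel y = L.firstLabel x}, hclopen.isOpen.mem_nhds rfl, ?_⟩
  have : CompactSpace {y : L.XSp | L.firstLabel y = L.firstLabel x} :=
    isCompact_iff_compactSpace.1 hclopen.isClosed.isCompact
  refine ⟨(Continuous.isClosedEmbedding (L.continuous_shift.comp continuous_subtype_val)
    ?_).isEmbedding, ?_⟩
  · rintro ⟨y, hy⟩ ⟨z, hz⟩ h
    have h' : ∀ i, y.1 (i + 1) = z.1 (i + 1) := fun i => congrFun (congrArg Subtype.val h) i
    refine Subtype.ext (Subtype.ext (funext fun i => ?_))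
    cases i with
    | succ i => exact h' i
    | zero =>
      refine Prod.ext (hy.trans hz.symm) ?_
      have a := y.2.1 0
      have b := z.2.1 0
      rw [← h' 0] at b
      exact hL.src_unique a b
  · rw [Set.range_domRestrict]
    have : L.shift '' {y | L.firstLabel y = L.firstLabel x} =
        (fun y : L.XSp => ((y.1 0).1, (y.1 0).2.1 2)) ⁻¹' {c | ∃ (e₀ : L.E 0) (e₁ : L.E 1),
          L.tgt e₀ = L.src e₁ ∧ L.lab e₀ = L.firstLabel x ∧ L.lab e₁ = c.1 ∧ L.tgt e₁ = c.2} := by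
      ext y
      constructor
      · rintro ⟨z, hz, rfl⟩
        obtain ⟨e, he⟩ := L.initVertex_spec z
        obtain ⟨e', he'⟩ := z.2.1 0
        exact ⟨e 0, e' 1, (he 0).2.1.trans (he' 1).1.symm, (he 0).2.2.trans hz, (he' 1).2.2,
          (he' 1).2.1⟩
      · rintro ⟨e₀, e₁, h₁, h₂, h₃, h₄⟩
        obtain ⟨e, he⟩ := L.initVertex_spec y
        have h₅ : e₁ = e 1 := hL 1 _ _ (h₃.trans (he 1).2.2.symm) (h₄.trans (he 1).2.1.symm)
        obtain ⟨u, hu⟩ := hL.exists_edge (L.initVertex y) e₀ (by rw [h₁, h₅, (he 1).1])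
        let w : ℕ → Fin N × L.Om := fun i => Nat.casesOn i (L.lab e₀, L.initVertex y) y.1
        have hw : ∀ i, L.IsEdge (w i).2 (w (i + 1)).1 (w (i + 1)).2 := by
          intro i
          cases i with
          | zero => exact L.initVertex_spec y
          | succ i => exact y.2.1 i
        let z : L.XSp := ⟨w, hw, u, hu⟩
        have hz : L.firstLabel z = L.firstLabel x := h₂
        exact ⟨z, hz, rfl⟩
    rw [this]
    refine (isOpen_discrete _).preimage ?_
    exact (continuous_fst.comp (L.continuous_entry 0)).prodMk
      ((L.continuous_coord 2).comp (continuous_snd.comp (L.continuous_entry 0)))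

theorem LeftResolving.isClopen_initVertex (hL : L.LeftResolving) {l : ℕ} (v : L.V l) :
    IsClopen {x : L.XSp | (L.initVertex x).1 l = v} := by
  have : {x : L.XSp | (L.initVertex x).1 l = v} =
      (fun y : L.XSp => ((y.1 0).1, (y.1 0).2.1 (l + 1))) ⁻¹' {c | ∃ e : L.E l,
        L.src e = v ∧ L.lab e = c.1 ∧ L.tgt e = c.2} := by
    ext x
    obtain ⟨e, he⟩ := L.initVertex_spec x
    constructor
    · intro hx
      exact ⟨e l, (he l).1.trans hx, (he l).2.2, (he l).2.1⟩
    · rintro ⟨f, h₁, h₂, h₃⟩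
      have h : f = e l := hL l _ _ (h₂.trans (he l).2.2.symm) (h₃.trans (he l).2.1.symm)
      exact ((he l).1.symm.trans (by rw [h])).trans h₁
  rw [this]
  refine (isClopen_discrete _).preimage ?_
  exact (continuous_fst.comp (L.continuous_entry 0)).prodMk
    ((L.continuous_coord (l + 1)).comp (continuous_snd.comp (L.continuous_entry 0)))

open Classical in
/-- The continuous characteristic function of a clopen set. -/
def charFun {Y : Type*} [TopologicalSpace Y] {A : Set Y} (hA : IsClopen A) : C(Y, ℂ) where
  toFun x := if x ∈ A then 1 else 0
  continuous_toFun := Continuous.if (fun a ha => by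
    rw [show {x | x ∈ A} = A from rfl, hA.frontier_eq] at ha
    exact ha.elim) continuous_const continuous_const

/-- The C*-algebra of a left-resolving `λ`-graph system: the reduced C*-algebra of the
Deaconu--Renault groupoid of `(L.XSp, L.shift)`. -/
abbrev OAlg (hL : L.LeftResolving) : StarSubalgebra ℂ (Hilb L.shift →L[ℂ] Hilb L.shift) :=
  redAlg hL.isLocalHomeomorph_shift

/-- The natural embedding of `C(L.XSp)`: a function on the unit space is extended by zero to the
groupoid and represented on `ℓ²`. -/
def diag (hL : L.LeftResolving) (a : C(L.XSp, ℂ)) : OAlg hL :=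
  ⟨regRep hL.isLocalHomeomorph_shift (graphFun hL.isLocalHomeomorph_shift 0 a), regRep_mem _ _⟩

/-- `S_α`, the image of the characteristic function of `{(x, 1, σ x) | λ_1(x) = α}`. -/
def S (hL : L.LeftResolving) (α : Fin N) : OAlg hL :=
  ⟨regRep hL.isLocalHomeomorph_shift (graphFun hL.isLocalHomeomorph_shift 1
    (charFun ((isClopen_discrete {α}).preimage L.continuous_firstLabel))), regRep_mem _ _⟩

/-- `E_v`, the image of the characteristic function of `{(x, 0, x) | v(x)_0^l = v}`, `v ∈ V l`. -/
def EProj (hL : L.LeftResolving) {l : ℕ} (v : L.V l) : OAlg hL :=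
  ⟨regRep hL.isLocalHomeomorph_shift (graphFun hL.isLocalHomeomorph_shift 0
    (charFun (hL.isClopen_initVertex v))), regRep_mem _ _⟩

/-- `S_μ = S_{μ_1} ⋯ S_{μ_m}`. -/
def SWord (hL : L.LeftResolving) (μ : List (Fin N)) : OAlg hL := (μ.map (S hL)).prod

/-- The commutative C*-subalgebra generated by all `S_μ E_v S_μ^*`. -/
def DAlg (hL : L.LeftResolving) : StarSubalgebra ℂ (OAlg hL) :=
  (StarAlgebra.adjoin ℂ {T | ∃ (μ : List (Fin N)) (l : ℕ) (v : L.V l), L.IsAdmissible μ ∧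
    T = SWord hL μ * EProj hL v * star (SWord hL μ)}).topologicalClosure

/-- The gauge action `ρ^{L,f}_t` with potential `f`. -/
def gauge (hL : L.LeftResolving) (f : C(L.XSp, ℤ)) (t : UnitAddCircle) : OAlg hL ≃⋆ₐ[ℂ] OAlg hL :=
  gaugeAut hL.isLocalHomeomorph_shift f t

/-- The map `Ψ_h` associated with `h` and the functions `k`, `l`:
`Ψ_h(f)(x) = ∑_{i=0}^{l(x)} f(σ₂^i (h x)) - ∑_{j=0}^{k(x)} f(σ₂^j (h (σ₁ x)))`. -/
def Psi {N₁ N₂ : ℕ} {L₁ : LambdaGraphSystem N₁} {L₂ : LambdaGraphSystem N₂}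
    (h : C(L₁.XSp, L₂.XSp)) (k l : C(L₁.XSp, ℕ)) (f : C(L₂.XSp, ℤ)) : C(L₁.XSp, ℤ) where
  toFun x := ∑ i ∈ Finset.range (l x + 1), f (L₂.shift^[i] (h x)) -
    ∑ j ∈ Finset.range (k x + 1), f (L₂.shift^[j] (h (L₁.shift x)))
  continuous_toFun := by
    have aux : ∀ (n : C(L₁.XSp, ℕ)) (F : ℕ → L₁.XSp → ℤ), (∀ i, Continuous (F i)) →
        Continuous fun x => ∑ i ∈ Finset.range (n x + 1), F i x := by
      intro n F hF
      refine continuous_iff_continuousAt.2 fun x => ?_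
      have hc : Continuous fun y => ∑ i ∈ Finset.range (n x + 1), F i y :=
        continuous_finsetSum _ fun i _ => hF i
      refine hc.continuousAt.congr ?_
      have hn : ∀ᶠ y in 𝓝 x, n y = n x :=
        n.continuous.continuousAt.eventually_mem ((isOpen_discrete {n x}).mem_nhds rfl)
      filter_upwards [hn] with y hy
      rw [hy]
    exact (aux l (fun i x => f (L₂.shift^[i] (h x))) fun i =>
      f.continuous.comp ((L₂.continuous_shift.iterate i).comp h.continuous)).sub
      (aux k (fun i x => f (L₂.shift^[i] (h (L₁.shift x)))) fun i =>
        f.continuous.comp ((L₂.continuous_shift.iterate i).comp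
          (h.continuous.comp L₁.continuous_shift)))

end LambdaGraphSystem

end

/-! For topologically free systems a continuous orbit equivalence is the same thing as an
isomorphism of groupoids, and everything else is carried along. With c the cocycle of l₁ - k₁,
`orbitMap` sends (x, n, z) to (h x, c(x, n, z), h z), which is a continuous homomorphism; h⁻¹, k₂,
l₂ give a map back. The composite fixes range and source, and its error in the degree is additive,
so by `eq_cocycle_of_map_mul` only the elements (x, 1, σ x) need checking. There continuity yields
σ^p = σ^(q+1) near x, with p - q the degree of the image, and topological freeness forces p = q + 1
(`orbitMap_orbitMap`). Freeness comes from condition (I): arbitrarily close to each path lie two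
paths with a long common label prefix and different labels later on, whereas σ^p = σ^q with p < q
makes all labels depend on the first q.

The resulting unitary between the ℓ² spaces intertwines the regular representations, and conjugation
by it is Φ. Units go to units, whence g ↦ g ∘ h⁻¹. By `cocycle_orbitMap` the cocycle of f pulls back
to that of Ψ_h(f), so the gauge unitaries are intertwined as well. The statement on the diagonals
follows once they are known to be all of C(X), by Stone–Weierstrass (`DAlg_eq_range_diag`). -/

noncomputable section

namespace DRGroupoid

/-! ### Additive functions on the groupoid, and continuity of maps into it. -/

section Additive

variable {X : Type*} {σ : X → X}

/-- An additive function on the groupoid is the cocycle of its restriction to the elements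
`(x, 1, σ x)`. -/
theorem eq_cocycle_of_map_mul (c : DRGroupoid σ → ℤ)
    (hc : ∀ (g k : DRGroupoid σ) (hk : g.src = k.rng), c (mul g k hk) = c g + c k)
    (g : DRGroupoid σ) : c g = cocycle (fun x => c (graphPt σ 1 x)) g := by
  have key : ∀ (n : ℕ) (x : X), c (graphPt σ n x) = birkhoff σ (fun x => c (graphPt σ 1 x)) n x := by
    intro n
    induction n with
    | zero =>
      intro x
      -- A unit is idempotent, so an additive function vanishes on it.
      have e : mul (graphPt σ 0 x) (graphPt σ 0 x) rfl = graphPt σ 0 x := ext rfl rfl rfl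
      have := hc (graphPt σ 0 x) (graphPt σ 0 x) rfl
      rw [e] at this
      simp only [birkhoff, Finset.range_zero, Finset.sum_empty]
      linarith
    | succ n ih =>
      intro x
      have e : mul (graphPt σ n x) (graphPt σ 1 (σ^[n] x)) rfl = graphPt σ (n + 1) x :=
        ext rfl (by change (n : ℤ) + ((1 : ℕ) : ℤ) = ((n + 1 : ℕ) : ℤ); push_cast; rfl)
          (Function.iterate_succ_apply' σ n x).symm
      rw [← e]
      refine (hc _ _ rfl).trans ?_
      rw [ih, birkhoff_add]
      simp [birkhoff]
  obtain ⟨p, q, h₁, h₂⟩ := g.2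
  change (p : ℤ) - q = g.deg at h₁
  change σ^[p] g.rng = σ^[q] g.src at h₂
  -- (x, p - q, z) (z, q, σ^q z) = (x, p, σ^p x), so values on graph points determine c.
  have e : mul g (graphPt σ q g.src) rfl = graphPt σ p g.rng :=
    ext rfl (by change g.deg + (q : ℤ) = p; linarith) h₂.symm
  have := hc g (graphPt σ q g.src) rfl
  rw [e, key, key] at this
  rw [cocycle_eq _ g h₁ h₂]
  linarith

end Additive

/-- A basic set prescribes its own exponents (p, q), while the values of F satisfy the relation with
locally constant exponents (P, Q) of the same difference. The two relations are compared by applying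
or cancelling a power of σ. -/
theorem continuous_of_eventually {X Y : Type*} [TopologicalSpace X] [TopologicalSpace Y]
    {σ : X → X} (hσ : IsLocalHomeomorph σ) {F : Y → DRGroupoid σ}
    (hr : Continuous fun y => (F y).rng) (hs : Continuous fun y => (F y).src)
    (hF : ∀ y, ∃ P Q : ℕ, ∀ᶠ y' in 𝓝 y,
      (P : ℤ) - Q = (F y').deg ∧ σ^[P] (F y').rng = σ^[Q] (F y').src) : Continuous F := by
  refine continuous_generateFrom_iff.2 ?_
  rintro _ ⟨p, q, U, V, hb, rfl⟩
  refine isOpen_iff_mem_nhds.2 fun y hy => ?_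
  obtain ⟨P, Q, hPQ⟩ := hF y
  obtain ⟨hd, -⟩ := hPQ.self_of_nhds
  have hd' : (P : ℤ) - Q = p - q := hd.trans hy.1
  have hU := hr.continuousAt.eventually_mem (hb.openU.mem_nhds hy.2.1)
  have hV := hs.continuousAt.eventually_mem (hb.openV.mem_nhds hy.2.2.1)
  rcases le_total p P with h | h
  · obtain ⟨d, rfl⟩ := Nat.exists_eq_add_of_le h
    obtain rfl : Q = q + d := by omega
    -- The known relation is σ^d applied to the wanted one; local injectivity of σ^d at the common
    -- point cancels it.
    obtain ⟨O, hO, hw, eO⟩ := exists_restrict hσ d (σ^[p] (F y).rng)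
    have inj : InjOn σ^[d] O := injOn_iff_injective.2 eO.injective
    have h₁ := ((hσ.continuous.iterate p).comp hr).continuousAt.eventually_mem (hO.mem_nhds hw)
    have hw' : σ^[q] (F y).src ∈ O := hy.2.2.2 ▸ hw
    have h₂ := ((hσ.continuous.iterate q).comp hs).continuousAt.eventually_mem (hO.mem_nhds hw')
    filter_upwards [hPQ, hU, hV, h₁, h₂] with y' a₁ a₂ a₃ a₄ a₅
    refine ⟨a₁.1.symm.trans hd', a₂, a₃, inj a₄ a₅ ?_⟩
    have := a₁.2
    rwa [add_comm p, add_comm q, Function.iterate_add_apply, Function.iterate_add_apply] at this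
  · obtain ⟨d, rfl⟩ := Nat.exists_eq_add_of_le h
    obtain rfl : q = Q + d := by omega
    filter_upwards [hPQ, hU, hV] with y' a₁ a₂ a₃
    refine ⟨a₁.1.symm.trans hd', a₂, a₃, ?_⟩
    rw [add_comm P, add_comm Q, Function.iterate_add_apply, Function.iterate_add_apply, a₁.2]

/-! ### The groupoid homomorphism of an orbit equivalence. -/

section OrbitMap

variable {X₁ X₂ : Type*} {σ₁ : X₁ → X₁} {σ₂ : X₂ → X₂} {h : X₁ → X₂} {k l : X₁ → ℕ}

theorem iterate_orbit (H : ∀ x, σ₂^[k x] (h (σ₁ x)) = σ₂^[l x] (h x)) (n : ℕ) (x : X₁) :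
    σ₂^[∑ i ∈ Finset.range n, l (σ₁^[i] x)] (h x) =
      σ₂^[∑ i ∈ Finset.range n, k (σ₁^[i] x)] (h (σ₁^[n] x)) := by
  induction n with
  | zero => simp
  | succ n ih =>
    rw [Finset.sum_range_succ, Finset.sum_range_succ, add_comm, Function.iterate_add_apply, ih,
      ← Function.iterate_add_apply, add_comm, Function.iterate_add_apply, ← H,
      ← Function.iterate_add_apply, Function.iterate_succ_apply']

/-- Both orbits are compared at h(σ^p x) = h(σ^q z): `iterate_orbit` reaches it from x and from z,
and each side is shifted further by the k-sum of the other. -/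
theorem iterate_orbit_pair (H : ∀ x, σ₂^[k x] (h (σ₁ x)) = σ₂^[l x] (h x)) {p q : ℕ} {x z : X₁}
    (e : σ₁^[p] x = σ₁^[q] z) :
    σ₂^[∑ i ∈ Finset.range p, l (σ₁^[i] x) + ∑ i ∈ Finset.range q, k (σ₁^[i] z)] (h x) =
      σ₂^[∑ i ∈ Finset.range p, k (σ₁^[i] x) + ∑ i ∈ Finset.range q, l (σ₁^[i] z)] (h z) := by
  rw [add_comm, Function.iterate_add_apply, iterate_orbit H, e, ← Function.iterate_add_apply,
    add_comm, Function.iterate_add_apply, ← iterate_orbit H, ← Function.iterate_add_apply]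

/-- The exponents of `iterate_orbit_pair` have the right difference, so they witness that the image
under `orbitMap` lies in the groupoid. -/
theorem cocycle_sub_natCast (g : DRGroupoid σ₁) {p q : ℕ} (e₁ : (p : ℤ) - q = g.deg)
    (e₂ : σ₁^[p] g.rng = σ₁^[q] g.src) :
    cocycle (fun x => (l x : ℤ) - k x) g =
      ((∑ i ∈ Finset.range p, l (σ₁^[i] g.rng) + ∑ i ∈ Finset.range q, k (σ₁^[i] g.src) : ℕ) : ℤ) -
      ((∑ i ∈ Finset.range p, k (σ₁^[i] g.rng) + ∑ i ∈ Finset.range q, l (σ₁^[i] g.src) : ℕ) : ℤ) := by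
  rw [cocycle_eq _ g e₁ e₂]
  simp only [birkhoff, Finset.sum_sub_distrib]
  push_cast
  ring

/-- The groupoid homomorphism `(x, n, z) ↦ (h x, c (x, n, z), h z)` induced by an orbit map `h`,
where `c` is the cocycle of `l - k`. -/
def orbitMap (H : ∀ x, σ₂^[k x] (h (σ₁ x)) = σ₂^[l x] (h x)) (g : DRGroupoid σ₁) :
    DRGroupoid σ₂ :=
  ⟨(h g.rng, cocycle (fun x => (l x : ℤ) - k x) g, h g.src), by
    obtain ⟨p, q, e₁, e₂⟩ := g.2
    exact ⟨_, _, (cocycle_sub_natCast g e₁ e₂).symm, iterate_orbit_pair H e₂⟩⟩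

theorem orbitMap_mul (H : ∀ x, σ₂^[k x] (h (σ₁ x)) = σ₂^[l x] (h x)) (g g' : DRGroupoid σ₁)
    (e : g.src = g'.rng) :
    orbitMap H (mul g g' e) = mul (orbitMap H g) (orbitMap H g') (congrArg h e) :=
  ext rfl (cocycle_mul _ g g' e) rfl

/-- On a basic set p and q are fixed, and the exponents of `iterate_orbit_pair` are continuous
functions into ℕ, hence locally constant; `continuous_of_eventually` applies. -/
theorem continuous_orbitMap [TopologicalSpace X₁] [TopologicalSpace X₂]
    (hσ₁ : IsLocalHomeomorph σ₁) (hσ₂ : IsLocalHomeomorph σ₂) (hh : Continuous h)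
    (hk : Continuous k) (hl : Continuous l) (H : ∀ x, σ₂^[k x] (h (σ₁ x)) = σ₂^[l x] (h x)) :
    Continuous (orbitMap H) := by
  refine continuous_of_eventually hσ₂ (hh.comp (continuous_rng hσ₁))
    (hh.comp (continuous_src hσ₁)) fun g => ?_
  obtain ⟨p, q, U, V, hb, -, -, hg⟩ :=
    exists_basic' hσ₁ g isOpen_univ (mem_univ _) isOpen_univ (mem_univ _)
  have hsum : ∀ {m : X₁ → ℕ} (_ : Continuous m) (n : ℕ),
      Continuous fun x => ∑ i ∈ Finset.range n, m (σ₁^[i] x) := fun hm n =>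
    continuous_finsetSum _ fun i _ => hm.comp (hσ₁.continuous.iterate i)
  have hP : Continuous fun g : DRGroupoid σ₁ =>
      ∑ i ∈ Finset.range p, l (σ₁^[i] g.rng) + ∑ i ∈ Finset.range q, k (σ₁^[i] g.src) :=
    ((hsum hl p).comp (continuous_rng hσ₁)).add ((hsum hk q).comp (continuous_src hσ₁))
  have hQ : Continuous fun g : DRGroupoid σ₁ =>
      ∑ i ∈ Finset.range p, k (σ₁^[i] g.rng) + ∑ i ∈ Finset.range q, l (σ₁^[i] g.src) :=
    ((hsum hk p).comp (continuous_rng hσ₁)).add ((hsum hl q).comp (continuous_src hσ₁))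
  refine ⟨∑ i ∈ Finset.range p, l (σ₁^[i] g.rng) + ∑ i ∈ Finset.range q, k (σ₁^[i] g.src),
    ∑ i ∈ Finset.range p, k (σ₁^[i] g.rng) + ∑ i ∈ Finset.range q, l (σ₁^[i] g.src), ?_⟩
  filter_upwards [hb.isOpen.mem_nhds hg,
    hP.continuousAt.eventually_mem ((isOpen_discrete {_}).mem_nhds rfl),
    hQ.continuousAt.eventually_mem ((isOpen_discrete {_}).mem_nhds rfl)] with g' a₁ a₂ a₃
  rw [mem_singleton_iff] at a₂ a₃
  rw [← a₂, ← a₃]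
  exact ⟨(cocycle_sub_natCast g' a₁.1.symm a₁.2.2.2).symm, iterate_orbit_pair H a₁.2.2.2⟩

/-- `(X, σ)` is topologically free: distinct powers of `σ` agree on no nonempty open set. -/
def TopologicallyFree {X : Type*} [TopologicalSpace X] (σ : X → X) : Prop :=
  ∀ (p q : ℕ) (x : X), (∀ᶠ y in 𝓝 x, σ^[p] y = σ^[q] y) → p = q

theorem orbitMap_orbitMap [TopologicalSpace X₁] [TopologicalSpace X₂]
    (hσ₁ : IsLocalHomeomorph σ₁) (hσ₂ : IsLocalHomeomorph σ₂) (hfree : TopologicallyFree σ₁)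
    (e : X₁ ≃ₜ X₂) {k₁ l₁ : X₁ → ℕ} {k₂ l₂ : X₂ → ℕ}
    (hk₁ : Continuous k₁) (hl₁ : Continuous l₁) (hk₂ : Continuous k₂) (hl₂ : Continuous l₂)
    (H₁ : ∀ x, σ₂^[k₁ x] (e (σ₁ x)) = σ₂^[l₁ x] (e x))
    (H₂ : ∀ y, σ₁^[k₂ y] (e.symm (σ₂ y)) = σ₁^[l₂ y] (e.symm y)) (g : DRGroupoid σ₁) :
    orbitMap H₂ (orbitMap H₁ g) = g := by
  -- The composite can differ from the identity only in the degree; d is this error.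
  let d : DRGroupoid σ₁ → ℤ := fun g => (orbitMap H₂ (orbitMap H₁ g)).deg - g.deg
  have hd : ∀ (g g' : DRGroupoid σ₁) (hg : g.src = g'.rng), d (mul g g' hg) = d g + d g' := by
    intro g g' hg
    have e₁ : (orbitMap H₂ (orbitMap H₁ (mul g g' hg))).deg =
        (orbitMap H₂ (orbitMap H₁ g)).deg + (orbitMap H₂ (orbitMap H₁ g')).deg := by
      rw [orbitMap_mul]
      exact cocycle_mul _ (orbitMap H₁ g) (orbitMap H₁ g') (congrArg e hg)
    have e₂ : (mul g g' hg).deg = g.deg + g'.deg := rfl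
    simp only [d]
    rw [e₁, e₂]
    ring
  have hcont : Continuous fun x => orbitMap H₂ (orbitMap H₁ (graphPt σ₁ 1 x)) :=
    (continuous_orbitMap hσ₂ hσ₁ e.symm.continuous hk₂ hl₂ H₂).comp
      ((continuous_orbitMap hσ₁ hσ₂ e.continuous hk₁ hl₁ H₁).comp
        (continuous_graphPt hσ₁.continuous 1))
  have hd1 : ∀ x, d (graphPt σ₁ 1 x) = 0 := by
    intro x
    obtain ⟨p, q, U, V, hb, -, -, hg⟩ := exists_basic' hσ₁
      (orbitMap H₂ (orbitMap H₁ (graphPt σ₁ 1 x))) isOpen_univ (mem_univ _) isOpen_univ (mem_univ _)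
    -- Near x the composite stays in one basic set. Since h⁻¹ ∘ h cancels, membership there reads
    -- σ^p y = σ^q (σ y), an identity on a whole neighbourhood.
    have : p = q + 1 := by
      refine hfree p (q + 1) x ?_
      filter_upwards [hcont.continuousAt.eventually_mem (hb.isOpen.mem_nhds hg)] with y hy
      have := hy.2.2.2
      change σ₁^[p] (e.symm (e y)) = σ₁^[q] (e.symm (e (σ₁ y))) at this
      rwa [e.symm_apply_apply, e.symm_apply_apply] at this
    simp only [d]
    rw [hg.1, this]
    change ((q + 1 : ℕ) : ℤ) - q - ((1 : ℕ) : ℤ) = 0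
    push_cast
    ring
  have h0 : d g = 0 := by
    rw [eq_cocycle_of_map_mul d hd g]
    simp [hd1, cocycle, birkhoff]
  exact ext (e.symm_apply_apply _) (sub_eq_zero.1 h0) (e.symm_apply_apply _)

/-- Both sides are additive in g, so they are compared on (x, 1, σ x) only. -/
theorem cocycle_orbitMap (H : ∀ x, σ₂^[k x] (h (σ₁ x)) = σ₂^[l x] (h x)) (f : X₂ → ℤ)
    (g : DRGroupoid σ₁) :
    cocycle f (orbitMap H g) =
      cocycle (fun x => ∑ i ∈ Finset.range (l x + 1), f (σ₂^[i] (h x)) -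
        ∑ j ∈ Finset.range (k x + 1), f (σ₂^[j] (h (σ₁ x)))) g := by
  rw [eq_cocycle_of_map_mul (fun g => cocycle f (orbitMap H g))
    (fun g g' hg => by
      rw [orbitMap_mul]
      exact cocycle_mul f (orbitMap H g) (orbitMap H g') (congrArg h hg)) g]
  congr 1
  funext x
  have hdeg : ((l x : ℕ) : ℤ) - (k x : ℕ) = (orbitMap H (graphPt σ₁ 1 x)).deg := by
    change _ = cocycle (fun x => (l x : ℤ) - k x) (graphPt σ₁ 1 x)
    rw [cocycle_eq (p := 1) (q := 0) _ _ (by simp; rfl) rfl]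
    simp [birkhoff]
    rfl
  -- The sums in Ψ_h run one term beyond the Birkhoff sums. By `H` the two extra terms are values of
  -- f at the same point, and they cancel.
  rw [cocycle_eq f (orbitMap H (graphPt σ₁ 1 x)) hdeg (H x).symm, Finset.sum_range_succ,
    Finset.sum_range_succ, H]
  change birkhoff σ₂ f (l x) (h x) - birkhoff σ₂ f (k x) (h (σ₁ x)) = _
  simp only [birkhoff]
  ring

end OrbitMap

end DRGroupoid

/-! ### Isomorphisms of groupoids and the induced isomorphisms of reduced algebras. -/

/-- The unitary between `ℓ²` spaces induced by a bijection of the index sets. -/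
def lpCongr {I J : Type*} (e : I ≃ J) :
    lp (fun _ : I => ℂ) 2 ≃ₗᵢ[ℂ] lp (fun _ : J => ℂ) 2 where
  toFun ξ := ⟨fun j => ξ (e.symm j), by
    have h := (memℓp_gen_iff (by norm_num)).1 (lp.memℓp ξ)
    exact (memℓp_gen_iff (by norm_num)).2 (e.symm.summable_iff.2 h)⟩
  invFun η := ⟨fun i => η (e i), by
    have h := (memℓp_gen_iff (by norm_num)).1 (lp.memℓp η)
    exact (memℓp_gen_iff (by norm_num)).2 (e.summable_iff.2 h)⟩
  map_add' _ _ := rfl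
  map_smul' _ _ := rfl
  left_inv ξ := by
    apply lp.ext
    funext i
    exact congrArg ξ (e.symm_apply_apply i)
  right_inv η := by
    apply lp.ext
    funext j
    exact congrArg η (e.apply_symm_apply j)
  norm_map' ξ := by
    rw [lp.norm_eq_tsum_rpow (by norm_num), lp.norm_eq_tsum_rpow (by norm_num)]
    congr 1
    exact e.symm.tsum_eq fun i => ‖ξ i‖ ^ (2 : ℝ≥0∞).toReal

namespace DRGroupoid

section Transport

variable {X₁ X₂ : Type*} [TopologicalSpace X₁] [TopologicalSpace X₂] {σ₁ : X₁ → X₁}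
  {σ₂ : X₂ → X₂}

/-- An isomorphism of topological groupoids over a homeomorphism of the unit spaces. -/
structure Iso (σ₁ : X₁ → X₁) (σ₂ : X₂ → X₂) where
  /-- the map on the groupoids -/
  toHomeomorph : DRGroupoid σ₁ ≃ₜ DRGroupoid σ₂
  /-- the map on the unit spaces -/
  base : X₁ ≃ₜ X₂
  rng_map : ∀ g, (toHomeomorph g).rng = base g.rng
  src_map : ∀ g, (toHomeomorph g).src = base g.src
  deg_inv_mul : ∀ (s t : DRGroupoid σ₁) (e : s.rng = t.rng),
    (toHomeomorph (mul (inv s) t e)).deg = -(toHomeomorph s).deg + (toHomeomorph t).deg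

namespace Iso

variable (Θ : Iso σ₁ σ₂)

theorem rng_eq_iff (s t : DRGroupoid σ₁) :
    (Θ.toHomeomorph s).rng = (Θ.toHomeomorph t).rng ↔ s.rng = t.rng := by
  rw [Θ.rng_map, Θ.rng_map, Θ.base.injective.eq_iff]

/-- Range and source agree automatically, so only the degree needs an axiom. Products s⁻¹ t are the
ones that occur in convolution. -/
theorem map_inv_mul (s t : DRGroupoid σ₁) (e : s.rng = t.rng) :
    Θ.toHomeomorph (mul (inv s) t e) =
      mul (inv (Θ.toHomeomorph s)) (Θ.toHomeomorph t) ((Θ.rng_eq_iff s t).2 e) :=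
  ext ((Θ.rng_map _).trans (Θ.src_map s).symm) (Θ.deg_inv_mul s t e)
    ((Θ.src_map _).trans (Θ.src_map t).symm)

/-- A unit satisfies g = g⁻¹ g, and the degree of the image of the right side is zero. -/
theorem deg_of_isUnit {g : DRGroupoid σ₁} (h₁ : g.deg = 0) (h₂ : g.src = g.rng) :
    (Θ.toHomeomorph g).deg = 0 := by
  have e : mul (inv g) g rfl = g := ext h₂ (by change -g.deg + g.deg = _; rw [h₁]; rfl) rfl
  have := Θ.deg_inv_mul g g rfl
  rw [e] at this
  linarith

theorem isUnit_iff (g : DRGroupoid σ₁) :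
    ((Θ.toHomeomorph g).deg = 0 ∧ (Θ.toHomeomorph g).src = (Θ.toHomeomorph g).rng) ↔
      (g.deg = 0 ∧ g.src = g.rng) := by
  rw [Θ.rng_map, Θ.src_map, Θ.base.injective.eq_iff]
  refine ⟨fun ⟨h₁, h₂⟩ => ⟨?_, h₂⟩, fun ⟨h₁, h₂⟩ => ⟨Θ.deg_of_isUnit h₁ h₂, h₂⟩⟩
  -- For the converse, the image of g coincides with the image of the unit at its range, and
  -- injectivity makes g that unit.
  let u : DRGroupoid σ₁ := graphPt σ₁ 0 g.rng
  have hu : Θ.toHomeomorph g = Θ.toHomeomorph u := by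
    refine ext ?_ ?_ ?_
    · rw [Θ.rng_map, Θ.rng_map]; rfl
    · rw [h₁, Θ.deg_of_isUnit rfl rfl]
    · rw [Θ.src_map, Θ.src_map, h₂]; rfl
  rw [Θ.toHomeomorph.injective hu]
  rfl

/-- The unitary `ℓ²(G₁) → ℓ²(G₂)` induced by an isomorphism of groupoids. -/
def unitary : Hilb σ₁ ≃ₗᵢ[ℂ] Hilb σ₂ := lpCongr Θ.toHomeomorph.toEquiv

/-- The transport of a compactly supported function along an isomorphism of groupoids. -/
def push (a : C_c(DRGroupoid σ₁, ℂ)) : C_c(DRGroupoid σ₂, ℂ) where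
  toFun g := a (Θ.toHomeomorph.symm g)
  continuous_toFun := a.continuous.comp Θ.toHomeomorph.symm.continuous
  hasCompactSupport' := a.hasCompactSupport.comp_homeomorph Θ.toHomeomorph.symm

theorem push_surjective : Function.Surjective Θ.push := fun b =>
  ⟨{ toFun := fun g => b (Θ.toHomeomorph g)
     continuous_toFun := b.continuous.comp Θ.toHomeomorph.continuous
     hasCompactSupport' := b.hasCompactSupport.comp_homeomorph Θ.toHomeomorph }, by
    ext g
    exact congrArg b (Θ.toHomeomorph.apply_symm_apply g)⟩

/-- The isomorphism maps the range fibre of t onto that of its image and preserves s⁻¹ t, so the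
convolution sum is merely reindexed. -/
theorem conj_regRep (hσ₁ : IsLocalHomeomorph σ₁) (hσ₂ : IsLocalHomeomorph σ₂)
    (a : C_c(DRGroupoid σ₁, ℂ)) :
    Θ.unitary.conjStarAlgEquiv (regRep hσ₁ a) = regRep hσ₂ (Θ.push a) := by
  ext ξ k
  obtain ⟨t, rfl⟩ := Θ.toHomeomorph.surjective k
  rw [regRep_apply]
  change regRep hσ₁ a (Θ.unitary.symm ξ) (Θ.toHomeomorph.symm (Θ.toHomeomorph t)) = _
  rw [Θ.toHomeomorph.symm_apply_apply, regRep_apply, conv, conv]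
  let E : {s : DRGroupoid σ₁ // s.rng = t.rng} ≃
      {s : DRGroupoid σ₂ // s.rng = (Θ.toHomeomorph t).rng} :=
    Θ.toHomeomorph.toEquiv.subtypeEquiv fun s => (Θ.rng_eq_iff s t).symm
  rw [← E.tsum_eq]
  refine tsum_congr fun s => ?_
  have e₁ : Θ.push a (E s).1 = a s.1 := congrArg a (Θ.toHomeomorph.symm_apply_apply s.1)
  rw [e₁]
  congr 1
  exact congrArg ξ (Θ.map_inv_mul s.1 t s.2)

/-- Stated for any unitary carrying generators to generators, so that it serves both for `Θ.unitary`
and for its inverse. -/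
theorem conj_mem_redAlg (hσ₁ : IsLocalHomeomorph σ₁) (hσ₂ : IsLocalHomeomorph σ₂)
    (W : Hilb σ₁ ≃ₗᵢ[ℂ] Hilb σ₂)
    (hW : ∀ a, ∃ b, W.conjStarAlgEquiv (regRep hσ₁ a) = regRep hσ₂ b)
    {T : Hilb σ₁ →L[ℂ] Hilb σ₁} (hT : T ∈ redAlg hσ₁) :
    W.conjStarAlgEquiv T ∈ redAlg hσ₂ := by
  have hc : Continuous W.conjStarAlgEquiv :=
    W.toContinuousLinearEquiv.conjContinuousAlgEquiv.continuous
  refine map_mem_closure hc hT fun S hS => ?_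
  have hle : StarAlgebra.adjoin ℂ (range (regRep hσ₁)) ≤
      (StarAlgebra.adjoin ℂ (range (regRep hσ₂))).comap
        (W.conjStarAlgEquiv : (Hilb σ₁ →L[ℂ] Hilb σ₁) →⋆ₐ[ℂ] (Hilb σ₂ →L[ℂ] Hilb σ₂)) := by
    refine StarAlgebra.adjoin_le ?_
    rintro _ ⟨a, rfl⟩
    obtain ⟨b, hb⟩ := hW a
    exact StarAlgebra.subset_adjoin ℂ _ ⟨b, hb.symm⟩
  exact hle hS

/-- The isomorphism of reduced C*-algebras induced by an isomorphism of groupoids. -/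
def redAlgEquiv (hσ₁ : IsLocalHomeomorph σ₁) (hσ₂ : IsLocalHomeomorph σ₂) :
    redAlg hσ₁ ≃⋆ₐ[ℂ] redAlg hσ₂ where
  toFun T := ⟨Θ.unitary.conjStarAlgEquiv T,
    conj_mem_redAlg hσ₁ hσ₂ _ (fun a => ⟨_, Θ.conj_regRep hσ₁ hσ₂ a⟩) T.2⟩
  invFun T := ⟨Θ.unitary.symm.conjStarAlgEquiv T, conj_mem_redAlg hσ₂ hσ₁ _ (fun b => by
    obtain ⟨a, rfl⟩ := Θ.push_surjective b
    refine ⟨a, ?_⟩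
    rw [← Θ.conj_regRep hσ₁ hσ₂]
    exact Θ.unitary.conjStarAlgEquiv.symm_apply_apply _) T.2⟩
  left_inv T := Subtype.ext (Θ.unitary.conjStarAlgEquiv.symm_apply_apply T.1)
  right_inv T := Subtype.ext (Θ.unitary.conjStarAlgEquiv.apply_symm_apply T.1)
  map_mul' S T := Subtype.ext (map_mul _ S.1 T.1)
  map_add' S T := Subtype.ext (map_add _ S.1 T.1)
  map_star' T := Subtype.ext (map_star _ T.1)
  map_smul' c T := Subtype.ext (map_smul _ c T.1)

theorem push_graphFun_zero [CompactSpace X₁] [T2Space X₁] [CompactSpace X₂] [T2Space X₂]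
    (hσ₁ : IsLocalHomeomorph σ₁) (hσ₂ : IsLocalHomeomorph σ₂) (a : C(X₁, ℂ)) :
    Θ.push (graphFun hσ₁ 0 a) = graphFun hσ₂ 0 (a.comp (Θ.base.symm : C(X₂, X₁))) := by
  classical
  ext k
  obtain ⟨g, rfl⟩ := Θ.toHomeomorph.surjective k
  change graphFun hσ₁ 0 a (Θ.toHomeomorph.symm (Θ.toHomeomorph g)) = _
  rw [Θ.toHomeomorph.symm_apply_apply]
  change (if g.deg = 0 ∧ g.src = g.rng then a g.rng else 0) =
    if (Θ.toHomeomorph g).deg = 0 ∧ (Θ.toHomeomorph g).src = (Θ.toHomeomorph g).rng then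
      a (Θ.base.symm (Θ.toHomeomorph g).rng) else 0
  by_cases hu : g.deg = 0 ∧ g.src = g.rng
  · rw [if_pos hu, if_pos ((Θ.isUnit_iff g).2 hu), Θ.rng_map, Θ.base.symm_apply_apply]
  · rw [if_neg hu, if_neg fun h => hu ((Θ.isUnit_iff g).1 h)]

theorem redAlgEquiv_gaugeAut (hσ₁ : IsLocalHomeomorph σ₁) (hσ₂ : IsLocalHomeomorph σ₂)
    (f₁ : C(X₁, ℤ)) (f₂ : C(X₂, ℤ))
    (hf : ∀ g, cocycle f₂ (Θ.toHomeomorph g) = cocycle f₁ g) (t : UnitAddCircle)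
    (T : redAlg hσ₁) :
    Θ.redAlgEquiv hσ₁ hσ₂ (gaugeAut hσ₁ f₁ t T) =
      gaugeAut hσ₂ f₂ t (Θ.redAlgEquiv hσ₁ hσ₂ T) := by
  have key : ∀ (t : UnitAddCircle) (ξ : Hilb σ₁),
      Θ.unitary (gaugeUnitary f₁ t ξ) = gaugeUnitary f₂ t (Θ.unitary ξ) := by
    intro t ξ
    apply lp.ext
    funext k
    obtain ⟨g, rfl⟩ := Θ.toHomeomorph.surjective k
    change gaugeUnitary f₁ t ξ (Θ.toHomeomorph.symm (Θ.toHomeomorph g)) =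
      (AddCircle.toCircle (cocycle f₂ (Θ.toHomeomorph g) • t) : ℂ) *
        ξ (Θ.toHomeomorph.symm (Θ.toHomeomorph g))
    rw [Θ.toHomeomorph.symm_apply_apply, hf]
    rfl
  refine Subtype.ext (ContinuousLinearMap.ext fun η => ?_)
  change Θ.unitary (gaugeUnitary f₁ t (T.1 ((gaugeUnitary f₁ t).symm (Θ.unitary.symm η)))) =
    gaugeUnitary f₂ t (Θ.unitary (T.1 (Θ.unitary.symm ((gaugeUnitary f₂ t).symm η))))
  rw [key]
  congr 4
  -- The inverse gauge unitary is the one at -t, so `key` at -t settles the remaining equality of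
  -- vectors.
  apply Θ.unitary.injective
  rw [gaugeUnitary_symm, gaugeUnitary_symm, key, Θ.unitary.apply_symm_apply,
    Θ.unitary.apply_symm_apply]

end Iso

/-- A continuous orbit equivalence between topologically free systems induces an isomorphism of
the groupoids. -/
def orbitIso (hσ₁ : IsLocalHomeomorph σ₁) (hσ₂ : IsLocalHomeomorph σ₂)
    (hf₁ : TopologicallyFree σ₁) (hf₂ : TopologicallyFree σ₂) (h : X₁ ≃ₜ X₂)
    (k₁ l₁ : C(X₁, ℕ)) (k₂ l₂ : C(X₂, ℕ))
    (H₁ : ∀ x, σ₂^[k₁ x] (h (σ₁ x)) = σ₂^[l₁ x] (h x))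
    (H₂ : ∀ y, σ₁^[k₂ y] (h.symm (σ₂ y)) = σ₁^[l₂ y] (h.symm y)) : Iso σ₁ σ₂ where
  toHomeomorph :=
    { toFun := orbitMap H₁
      invFun := orbitMap H₂
      left_inv := orbitMap_orbitMap hσ₁ hσ₂ hf₁ h k₁.continuous l₁.continuous k₂.continuous
        l₂.continuous H₁ H₂
      right_inv := orbitMap_orbitMap hσ₂ hσ₁ hf₂ h.symm k₂.continuous l₂.continuous
        k₁.continuous l₁.continuous H₂ H₁
      continuous_toFun := continuous_orbitMap hσ₁ hσ₂ h.continuous k₁.continuous l₁.continuous H₁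
      continuous_invFun :=
        continuous_orbitMap hσ₂ hσ₁ h.symm.continuous k₂.continuous l₂.continuous H₂ }
  base := h
  rng_map _ := rfl
  src_map _ := rfl
  deg_inv_mul s t e := by
    change cocycle _ (mul (inv s) t e) = -cocycle _ s + cocycle _ t
    rw [← cocycle_inv]
    exact cocycle_mul _ (inv s) t e

end Transport

end DRGroupoid

/-! ### Construction of paths, and topological freeness from condition (I). -/

/-- Above level l one lifts by sections of ι, below it one applies ι. The induction shifts the whole
tower by one level, so that the lifting always begins at level 0. -/
theorem exists_thread {V : ℕ → Type*} (ι : ∀ l, V (l + 1) → V l)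
    (hι : ∀ l, Function.Surjective (ι l)) (l : ℕ) (v : V l) :
    ∃ u : ∀ k, V k, (∀ k, ι k (u (k + 1)) = u k) ∧ u l = v := by
  induction l generalizing V with
  | zero =>
    choose s hs using hι
    exact ⟨fun k => Nat.rec (motive := V) v (fun k w => s k w) k, fun k => hs k _, rfl⟩
  | succ l ih =>
    obtain ⟨u, hu, hl⟩ := ih (V := fun k => V (k + 1)) (fun k => ι (k + 1)) (fun k => hι (k + 1)) v
    refine ⟨fun k => Nat.casesOn (motive := V) k (ι 0 (u 0)) u, fun k => ?_, hl⟩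
    cases k with
    | zero => rfl
    | succ k => exact hu k

namespace LambdaGraphSystem

variable {N : ℕ} (L : LambdaGraphSystem N)

theorem exists_om {l : ℕ} (v : L.V l) : ∃ u : L.Om, u.1 l = v := by
  obtain ⟨u, hu, hl⟩ := exists_thread (fun l => L.ι (l := l)) L.ι_surjective l v
  exact ⟨⟨u, hu⟩, hl⟩

/-- The local property projects edges along ι. -/
theorem exists_edge_below {l : ℕ} (e : L.E (l + 1)) :
    ∃ e' : L.E l, L.src e' = L.ι (L.src e) ∧ L.tgt e' = L.ι (L.tgt e) ∧ L.lab e' = L.lab e := by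
  obtain ⟨φ, hφ⟩ := L.local_property (L.ι (L.src e)) (L.tgt e)
  exact ⟨(φ ⟨e, rfl, rfl⟩).1, (φ ⟨e, rfl, rfl⟩).2.1, (φ ⟨e, rfl, rfl⟩).2.2, hφ _⟩

variable {L}

theorem om_eq_of_le {u v : L.Om} {l m : ℕ} (h : l ≤ m) (e : u.1 m = v.1 m) : u.1 l = v.1 l := by
  induction m, h using Nat.le_induction with
  | base => exact e
  | succ m _ ih => exact ih (by rw [← u.2, ← v.2, e])

namespace LeftResolving

/-- Project e to level 0 and extend that edge to an edge of the limit graph ending at v;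
left-resolvingness identifies its component at level l with e. -/
theorem exists_isEdge_to (hL : L.LeftResolving) (v : L.Om) {l : ℕ} (e : L.E l)
    (he : L.tgt e = v.1 (l + 1)) : ∃ u, L.IsEdge u (L.lab e) v ∧ u.1 l = L.src e := by
  have down : ∀ (l : ℕ) (e : L.E l), L.tgt e = v.1 (l + 1) →
      ∃ e₀ : L.E 0, L.tgt e₀ = v.1 1 ∧ L.lab e₀ = L.lab e := by
    intro l
    induction l with
    | zero => exact fun e he => ⟨e, he, rfl⟩
    | succ l ih =>
      intro e he
      obtain ⟨e', -, h₂, h₃⟩ := L.exists_edge_below e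
      obtain ⟨e₀, h₄, h₅⟩ := ih e' (by rw [h₂, he, v.2])
      exact ⟨e₀, h₄, h₅.trans h₃⟩
  obtain ⟨e₀, h₁, h₂⟩ := down l e he
  obtain ⟨u, hu⟩ := hL.exists_edge v e₀ h₁
  rw [h₂] at hu
  refine ⟨u, hu, ?_⟩
  obtain ⟨f, hf⟩ := hu
  rw [← (hf l).1, hL l (f l) e (hf l).2.2 ((hf l).2.1.trans he.symm)]

/-- Compactness: the pairs admissible at level l form nonempty closed sets, decreasing in l because
edges project downwards. -/
theorem exists_isEdge_from (u : L.Om) : ∃ w : Fin N × L.Om, L.IsEdge u w.1 w.2 := by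
  let C : ℕ → Set (Fin N × L.Om) := fun l =>
    {w | ∃ e : L.E l, L.src e = u.1 l ∧ L.tgt e = w.2.1 (l + 1) ∧ L.lab e = w.1}
  have hC : ∀ l, IsClosed (C l) := by
    intro l
    have hc : Continuous fun w : Fin N × L.Om => (w.1, w.2.1 (l + 1)) :=
      continuous_fst.prodMk ((L.continuous_coord (l + 1)).comp continuous_snd)
    exact (isClosed_discrete {c : Fin N × L.V (l + 1) |
      ∃ e : L.E l, L.src e = u.1 l ∧ L.tgt e = c.2 ∧ L.lab e = c.1}).preimage hc
  obtain ⟨w, hw⟩ := IsCompact.nonempty_iInter_of_sequence_nonempty_isCompact_isClosed C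
    (fun l w hw => by
      obtain ⟨e, h₁, h₂, h₃⟩ := hw
      obtain ⟨e', h₁', h₂', h₃'⟩ := L.exists_edge_below e
      exact ⟨e', by rw [h₁', h₁, u.2], by rw [h₂', h₂, w.2.2], h₃'.trans h₃⟩)
    (fun l => by
      obtain ⟨e, he⟩ := L.exists_src (u.1 l)
      obtain ⟨v, hv⟩ := L.exists_om (L.tgt e)
      exact ⟨(L.lab e, v), e, he, hv.symm, rfl⟩)
    (hC 0).isCompact hC
  exact ⟨w, L.isEdge_iff.2 fun l => mem_iInter.1 hw l⟩

theorem initVertex_eq (hL : L.LeftResolving) {x : L.XSp} {u : L.Om}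
    (h : L.IsEdge u (x.1 0).1 (x.1 0).2) : L.initVertex x = u :=
  hL.src_unique (L.initVertex_spec x) h

theorem initVertex_shift (hL : L.LeftResolving) (x : L.XSp) :
    L.initVertex (L.shift x) = (x.1 0).2 :=
  hL.initVertex_eq (x := L.shift x) (x.2.1 0)

theorem exists_initVertex_eq (hL : L.LeftResolving) (u : L.Om) :
    ∃ x : L.XSp, L.initVertex x = u := by
  choose s hs using exists_isEdge_from (L := L)
  let x : ℕ → Fin N × L.Om := fun n => Nat.rec (s u) (fun _ w => s w.2) n
  let y : L.XSp := ⟨x, fun i => hs (x i).2, u, hs u⟩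
  exact ⟨y, hL.initVertex_eq (x := y) (hs u)⟩

theorem exists_cons (hL : L.LeftResolving) (x : L.XSp) {l : ℕ} (e : L.E l)
    (he : L.tgt e = (L.initVertex x).1 (l + 1)) :
    ∃ z : L.XSp, L.shift z = x ∧ L.firstLabel z = L.lab e ∧ (L.initVertex z).1 l = L.src e := by
  obtain ⟨u, hu, hl⟩ := hL.exists_isEdge_to (L.initVertex x) e he
  let w : ℕ → Fin N × L.Om := fun i => Nat.casesOn i (L.lab e, L.initVertex x) x.1
  have hw : ∀ i, L.IsEdge (w i).2 (w (i + 1)).1 (w (i + 1)).2 := by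
    intro i
    cases i with
    | zero => exact L.initVertex_spec x
    | succ i => exact x.2.1 i
  let z : L.XSp := ⟨w, hw, u, hu⟩
  refine ⟨z, rfl, rfl, ?_⟩
  rw [hL.initVertex_eq (x := z) hu, hl]

/-- The path is built backwards: start at a point over its end and prepend edges. Sigma types absorb
the mismatch between l + (n + 1) and (l + 1) + n in the induction. -/
theorem exists_label_path (hL : L.LeftResolving) (n : ℕ) {l : ℕ} (v : L.V l)
    (e : ℕ → Σ l, L.E l) (h₀ : (⟨_, L.src (e 0).2⟩ : Σ l, L.V l) = ⟨l, v⟩)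
    (he : ∀ n, (⟨_, L.tgt (e n).2⟩ : Σ l, L.V l) = ⟨_, L.src (e (n + 1)).2⟩) :
    ∃ z : L.XSp, (L.initVertex z).1 l = v ∧ ∀ i < n, (z.1 i).1 = L.lab (e i).2 := by
  induction n generalizing l e with
  | zero =>
    obtain ⟨u, hu⟩ := L.exists_om v
    obtain ⟨x, hx⟩ := hL.exists_initVertex_eq u
    exact ⟨x, by rw [hx, hu], fun i hi => absurd hi (Nat.not_lt_zero i)⟩
  | succ n ih =>
    obtain ⟨x, hx, hlab⟩ := ih (L.tgt (e 0).2) (fun i => e (i + 1)) (he 0).symm fun i => he (i + 1)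
    obtain ⟨z, rfl, h₂, h₃⟩ := hL.exists_cons x (e 0).2 hx.symm
    refine ⟨z, ?_, fun i hi => ?_⟩
    · cases h₀
      exact h₃
    · cases i with
      | zero => exact h₂
      | succ i => exact hlab i (by omega)

theorem exists_of_mem_followers (hL : L.LeftResolving) {l : ℕ} {v : L.V l} {a : ℕ → Fin N}
    (ha : a ∈ L.followers v) (n : ℕ) :
    ∃ z : L.XSp, (L.initVertex z).1 l = v ∧ ∀ i < n, (z.1 i).1 = a i := by
  obtain ⟨e, h₀, h₁, h₂⟩ := ha
  obtain ⟨z, hz, hlab⟩ := hL.exists_label_path n v (fun i => ⟨l + i, e i⟩)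
    (congrArg (Sigma.mk l) h₀) (fun i => congrArg (Sigma.mk (l + i + 1)) (h₁ i))
  exact ⟨z, hz, fun i hi => (hlab i hi).trans (h₂ i)⟩

/-- The first n edges of x are put in front of y. Each prepended edge costs one level of agreement,
which is why level m + n is required of y. -/
theorem exists_prepend (hL : L.LeftResolving) (n m : ℕ) (x y : L.XSp)
    (hy : (L.initVertex y).1 (m + n) = (L.initVertex (L.shift^[n] x)).1 (m + n)) :
    ∃ z : L.XSp, L.shift^[n] z = y ∧ (L.initVertex z).1 m = (L.initVertex x).1 m ∧
      ∀ i < n, (z.1 i).1 = (x.1 i).1 ∧ (z.1 i).2.1 m = (x.1 i).2.1 m := by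
  induction n generalizing m x with
  | zero => exact ⟨y, rfl, hy, fun i hi => absurd hi (Nat.not_lt_zero i)⟩
  | succ n ih =>
    obtain ⟨z', rfl, h₂, h₃⟩ := ih (m + 1) (L.shift x) (by
      rw [show m + 1 + n = m + (n + 1) by omega]
      exact hy)
    rw [hL.initVertex_shift] at h₂
    obtain ⟨e, he⟩ := L.initVertex_spec x
    obtain ⟨z, rfl, h₄, h₅⟩ := hL.exists_cons z' (e m) ((he m).2.1.trans h₂.symm)
    rw [hL.initVertex_shift] at h₂
    refine ⟨z, rfl, h₅.trans (he m).1, fun i hi => ?_⟩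
    cases i with
    | zero => exact ⟨h₄.trans (he m).2.2, om_eq_of_le (Nat.le_succ m) h₂⟩
    | succ i =>
      obtain ⟨a, b⟩ := h₃ i (by omega)
      exact ⟨a, om_eq_of_le (Nat.le_succ m) b⟩

end LeftResolving

theorem shift_iterate_apply (n : ℕ) (x : L.XSp) (i : ℕ) : (L.shift^[n] x).1 i = x.1 (i + n) := by
  induction n generalizing x with
  | zero => rfl
  | succ n ih =>
    rw [Function.iterate_succ_apply, ih]
    rfl

theorem tendsto_of_agree {z : ℕ → L.XSp} {x : L.XSp}
    (h : ∀ n, ∀ i < n, ((z n).1 i).1 = (x.1 i).1 ∧ ((z n).1 i).2.1 n = (x.1 i).2.1 n) :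
    Filter.Tendsto z Filter.atTop (𝓝 x) := by
  refine tendsto_subtype_rng.2 (tendsto_pi_nhds.2 fun i => ?_)
  refine Filter.Tendsto.prodMk_nhds (tendsto_nhds_of_eventually_eq ?_)
    (tendsto_subtype_rng.2 (tendsto_pi_nhds.2 fun l => tendsto_nhds_of_eventually_eq ?_))
  · filter_upwards [Filter.eventually_gt_atTop i] with n hn
    exact (h n i hn).1
  · filter_upwards [Filter.eventually_gt_atTop i, Filter.eventually_ge_atTop l] with n hn hl
    exact om_eq_of_le hl (h n i hn).2

theorem exists_fork (hL : L.LeftResolving) (hI : L.ConditionI) (x : L.XSp) (n : ℕ) :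
    ∃ z z' : L.XSp, (∃ j, (z.1 j).1 ≠ (z'.1 j).1) ∧
      (∀ i < n, (z.1 i).1 = (x.1 i).1 ∧ (z.1 i).2.1 n = (x.1 i).2.1 n) ∧
      ∀ i < n, (z'.1 i).1 = (x.1 i).1 ∧ (z'.1 i).2.1 n = (x.1 i).2.1 n := by
  -- Level n + n is chosen because prepending n edges uses up n levels and agreement at level n must
  -- remain.
  obtain ⟨a, ha, b, hb, hab⟩ := hI (n + n) ((L.initVertex (L.shift^[n] x)).1 (n + n))
  obtain ⟨j, hj⟩ := Function.ne_iff.1 hab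
  obtain ⟨y, hy, hya⟩ := hL.exists_of_mem_followers ha (j + 1)
  obtain ⟨y', hy', hyb⟩ := hL.exists_of_mem_followers hb (j + 1)
  obtain ⟨z, rfl, -, hz⟩ := hL.exists_prepend n n x y hy
  obtain ⟨z', rfl, -, hz'⟩ := hL.exists_prepend n n x y' hy'
  refine ⟨z, z', ⟨j + n, ?_⟩, hz, hz'⟩
  rw [← shift_iterate_apply, ← shift_iterate_apply, hya j (Nat.lt_succ_self j),
    hyb j (Nat.lt_succ_self j)]
  exact hj

/-- Condition (I) makes the shift topologically free. -/
theorem LeftResolving.topologicallyFree (hL : L.LeftResolving) (hI : L.ConditionI) :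
    DRGroupoid.TopologicallyFree L.shift := by
  intro p q x hev
  by_contra hne
  wlog hpq : p < q generalizing p q
  · exact this q p (hev.mono fun y hy => hy.symm) (Ne.symm hne) (by omega)
  -- Both sequences converge to x, so for some n ≥ q the two forked points lie where σ^p = σ^q.
  choose z z' hne' hz hz' using exists_fork hL hI x
  obtain ⟨n, h₁, h₂, h₃⟩ := ((tendsto_of_agree hz).eventually hev |>.and
    ((tendsto_of_agree hz').eventually hev |>.and (Filter.eventually_ge_atTop q))).exists
  obtain ⟨j, hj⟩ := hne' n
  have per : ∀ y : L.XSp, L.shift^[p] y = L.shift^[q] y → ∀ i, y.1 (i + q) = y.1 (i + p) := by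
    intro y hy i
    rw [← shift_iterate_apply, ← hy, shift_iterate_apply]
  -- Periodicity reduces every index ≥ q to a smaller one, and below n ≥ q both points carry the
  -- labels of x.
  have key : ∀ i, ((z n).1 i).1 = ((z' n).1 i).1 := by
    intro i
    induction i using Nat.strong_induction_on with
    | _ i ih =>
      by_cases hi : i < n
      · exact (hz n i hi).1.trans (hz' n i hi).1.symm
      · obtain ⟨d, rfl⟩ := Nat.exists_eq_add_of_le (show q ≤ i by omega)
        rw [add_comm q d, per _ h₁, per _ h₂]
        exact ih (d + p) (by omega)
  exact hj (key j)

end LambdaGraphSystem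

/-! ### Explicit operators, and the representation of C(X). -/

/-- If `T ξ = c · (ξ ∘ τ)` with `τ` injective on the support of `c`, then `T T^*` is multiplication
by `|c|²`. -/
theorem mul_star_apply_of_weighted_comp {I : Type*}
    (T : lp (fun _ : I => ℂ) 2 →L[ℂ] lp (fun _ : I => ℂ) 2) (c : I → ℂ) (τ : I → I)
    (hT : ∀ ξ t, T ξ t = c t * ξ (τ t))
    (hinj : ∀ t t', c t ≠ 0 → c t' ≠ 0 → τ t = τ t' → t = t')
    (ξ : lp (fun _ : I => ℂ) 2) (t : I) :
    T (star T ξ) t = c t * (starRingEnd ℂ (c t) * ξ t) := by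
  classical
  rw [hT]
  by_cases hc : c t = 0
  · rw [hc, zero_mul, zero_mul]
  congr 1
  -- By injectivity only t contributes, so T δ_{τ t} = c(t) δ_t; pairing with ξ gives (T^* ξ)(τ t).
  have hs : T (lp.single 2 (τ t) (1 : ℂ)) = lp.single 2 t (c t) := by
    apply lp.ext
    funext t'
    rw [hT, lp.single_apply, lp.single_apply]
    by_cases h : t' = t
    · subst h
      rw [Pi.single_eq_same, Pi.single_eq_same, mul_one]
    · rw [Pi.single_eq_of_ne h]
      by_cases hc' : c t' = 0
      · rw [hc', zero_mul]
      · rw [Pi.single_eq_of_ne fun e => h (hinj t' t hc' hc e), mul_zero]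
  have h₁ : inner ℂ (lp.single 2 (τ t) (1 : ℂ)) (star T ξ) = (star T ξ) (τ t) := by
    rw [lp.inner_single_left]
    simp
  rw [← h₁, ContinuousLinearMap.star_eq_adjoint, ContinuousLinearMap.adjoint_inner_right, hs,
    lp.inner_single_left]
  simp [mul_comm]

namespace DRGroupoid

theorem inv_graphPt_zero_mul {X : Type*} {σ : X → X} (t : DRGroupoid σ) :
    mul (inv (graphPt σ 0 t.rng)) t rfl = t :=
  ext rfl (by change -((0 : ℕ) : ℤ) + t.deg = t.deg; simp) rfl

theorem inv_graphPt_mul_inv_graphPt_one_mul {X : Type*} {σ : X → X} (n : ℕ) (t : DRGroupoid σ) :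
    mul (inv (graphPt σ n (mul (inv (graphPt σ 1 t.rng)) t rfl).rng))
      (mul (inv (graphPt σ 1 t.rng)) t rfl) rfl = mul (inv (graphPt σ (n + 1) t.rng)) t rfl := by
  refine ext rfl ?_ rfl
  change -(n : ℤ) + (-((1 : ℕ) : ℤ) + t.deg) = -((n + 1 : ℕ) : ℤ) + t.deg
  push_cast
  ring

variable {X : Type*} [TopologicalSpace X] [CompactSpace X] [T2Space X] {σ : X → X}

/-- Each range fibre meets the support of `graphFun` in at most one point, so the convolution has a
single term. -/
theorem regRep_graphFun_apply (hσ : IsLocalHomeomorph σ) (n : ℕ) (a : C(X, ℂ)) (ξ : Hilb σ)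
    (t : DRGroupoid σ) :
    regRep hσ (graphFun hσ n a) ξ t = a t.rng * ξ (mul (inv (graphPt σ n t.rng)) t rfl) := by
  classical
  rw [regRep_apply, conv, tsum_eq_single ⟨graphPt σ n t.rng, rfl⟩]
  · congr 1
    exact if_pos ⟨rfl, rfl⟩
  · intro s hs
    have : graphFun hσ n a s.1 = 0 := by
      refine if_neg fun h => hs (Subtype.ext (ext s.2 h.1 ?_))
      rw [h.2, s.2]
      rfl
    rw [this, zero_mul]

theorem regRep_graphFun_zero_apply (hσ : IsLocalHomeomorph σ) (a : C(X, ℂ)) (ξ : Hilb σ)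
    (t : DRGroupoid σ) : regRep hσ (graphFun hσ 0 a) ξ t = a t.rng * ξ t := by
  rw [regRep_graphFun_apply]
  exact congrArg (fun s => a t.rng * ξ s) (inv_graphPt_zero_mul t)

/-- The representation of `C(X)` in the reduced C*-algebra by functions on the unit space. -/
def unitRep (hσ : IsLocalHomeomorph σ) : C(X, ℂ) →⋆ₐ[ℂ] redAlg hσ where
  toFun a := ⟨regRep hσ (graphFun hσ 0 a), regRep_mem _ _⟩
  map_one' := by
    refine Subtype.ext (ContinuousLinearMap.ext fun ξ => lp.ext (funext fun t => ?_))
    rw [regRep_graphFun_zero_apply]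
    exact one_mul _
  map_mul' a b := by
    refine Subtype.ext (ContinuousLinearMap.ext fun ξ => lp.ext (funext fun t => ?_))
    rw [regRep_graphFun_zero_apply]
    change _ = regRep hσ (graphFun hσ 0 a) (regRep hσ (graphFun hσ 0 b) ξ) t
    rw [regRep_graphFun_zero_apply, regRep_graphFun_zero_apply]
    exact mul_assoc _ _ _
  map_zero' := by
    refine Subtype.ext (ContinuousLinearMap.ext fun ξ => lp.ext (funext fun t => ?_))
    rw [regRep_graphFun_zero_apply]
    exact zero_mul _
  map_add' a b := by
    refine Subtype.ext (ContinuousLinearMap.ext fun ξ => lp.ext (funext fun t => ?_))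
    rw [regRep_graphFun_zero_apply]
    change _ = regRep hσ (graphFun hσ 0 a) ξ t + regRep hσ (graphFun hσ 0 b) ξ t
    rw [regRep_graphFun_zero_apply, regRep_graphFun_zero_apply]
    exact add_mul _ _ _
  commutes' r := by
    refine Subtype.ext (ContinuousLinearMap.ext fun ξ => lp.ext (funext fun t => ?_))
    rw [regRep_graphFun_zero_apply]
    change _ = r * ξ t
    simp
  map_star' a := by
    refine Subtype.ext ?_
    change regRep hσ (graphFun hσ 0 (star a)) = star (regRep hσ (graphFun hσ 0 a))
    rw [ContinuousLinearMap.star_eq_adjoint, ContinuousLinearMap.eq_adjoint_iff]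
    intro ξ η
    rw [lp.inner_eq_tsum, lp.inner_eq_tsum]
    refine tsum_congr fun t => ?_
    rw [regRep_graphFun_zero_apply, regRep_graphFun_zero_apply]
    simp
    ring

theorem unitRep_apply (hσ : IsLocalHomeomorph σ) (a : C(X, ℂ)) (ξ : Hilb σ) (t : DRGroupoid σ) :
    (unitRep hσ a).1 ξ t = a t.rng * ξ t :=
  regRep_graphFun_zero_apply hσ a ξ t

theorem unitRep_injective (hσ : IsLocalHomeomorph σ) : Function.Injective (unitRep hσ) := by
  classical
  intro a b hab
  ext x
  have h : (unitRep hσ a).1 (lp.single 2 (graphPt σ 0 x) 1) (graphPt σ 0 x) =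
      (unitRep hσ b).1 (lp.single 2 (graphPt σ 0 x) 1) (graphPt σ 0 x) := by rw [hab]
  rw [unitRep_apply, unitRep_apply, lp.single_apply_self, mul_one, mul_one] at h
  exact h

/-- An injective *-homomorphism of C*-algebras is isometric; this will make the image of C(X)
closed. -/
theorem isometry_unitRep (hσ : IsLocalHomeomorph σ) : Isometry (unitRep hσ) := by
  have h := NonUnitalStarAlgHom.isometry ((redAlg hσ).subtype.comp (unitRep hσ))
    (Subtype.val_injective.comp (unitRep_injective hσ))
  exact h

end DRGroupoid

/-! ### The diagonal subalgebra is C(X). -/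

namespace LambdaGraphSystem

open DRGroupoid

variable {N : ℕ} {L : LambdaGraphSystem N}

variable (L) in
/-- The paths whose label sequence starts with `μ`. -/
def cylinder : List (Fin N) → Set L.XSp
  | [] => univ
  | α :: μ => L.firstLabel ⁻¹' {α} ∩ L.shift ⁻¹' cylinder μ

theorem isClopen_cylinder (μ : List (Fin N)) : IsClopen (L.cylinder μ) := by
  induction μ with
  | nil => exact isClopen_univ
  | cons α μ ih =>
    exact ((isClopen_discrete {α}).preimage L.continuous_firstLabel).inter
      (ih.preimage L.continuous_shift)

theorem mem_cylinder {μ : List (Fin N)} {x : L.XSp} :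
    x ∈ L.cylinder μ ↔ μ = (List.range μ.length).map fun i => (x.1 i).1 := by
  induction μ generalizing x with
  | nil => simp [cylinder]
  | cons α μ ih =>
    rw [List.length_cons, List.range_succ_eq_map, List.map_cons, List.map_map, List.cons.injEq]
    exact and_congr eq_comm ih

/-- The shift forgets only the first label, fixed by the cylinder, and the first vertex, which is
the unique initial vertex of the shifted path. -/
theorem LeftResolving.injOn_shift_cylinder (hL : L.LeftResolving) (μ : List (Fin N)) :
    InjOn L.shift^[μ.length] (L.cylinder μ) := by
  induction μ with
  | nil => exact Function.injective_id.injOn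
  | cons α μ ih =>
    intro x hx y hy h
    have h' : L.shift x = L.shift y := ih hx.2 hy.2 h
    have h'' : ∀ i, x.1 (i + 1) = y.1 (i + 1) := fun i => congrFun (congrArg Subtype.val h') i
    refine Subtype.ext (funext fun i => ?_)
    cases i with
    | succ i => exact h'' i
    | zero =>
      refine Prod.ext (hx.1.trans hy.1.symm) ?_
      rw [← hL.initVertex_shift, ← hL.initVertex_shift, h']

theorem charFun_of_mem {Y : Type*} [TopologicalSpace Y] {A : Set Y} (hA : IsClopen A) {x : Y}
    (hx : x ∈ A) : charFun hA x = 1 := if_pos hx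

theorem charFun_of_notMem {Y : Type*} [TopologicalSpace Y] {A : Set Y} (hA : IsClopen A) {x : Y}
    (hx : x ∉ A) : charFun hA x = 0 := if_neg hx

theorem charFun_inter {Y : Type*} [TopologicalSpace Y] {A B : Set Y} (hA : IsClopen A)
    (hB : IsClopen B) (x : Y) : charFun (hA.inter hB) x = charFun hA x * charFun hB x := by
  by_cases h₁ : x ∈ A
  · by_cases h₂ : x ∈ B
    · rw [charFun_of_mem (hA.inter hB) ⟨h₁, h₂⟩, charFun_of_mem _ h₁, charFun_of_mem _ h₂, one_mul]
    · rw [charFun_of_notMem (hA.inter hB) fun h => h₂ h.2, charFun_of_notMem _ h₂, mul_zero]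
  · rw [charFun_of_notMem (hA.inter hB) fun h => h₁ h.1, charFun_of_notMem _ h₁, zero_mul]

theorem SWord_apply (hL : L.LeftResolving) (μ : List (Fin N)) (ξ : Hilb L.shift)
    (t : DRGroupoid L.shift) :
    (SWord hL μ).1 ξ t = charFun (isClopen_cylinder μ) t.rng *
      ξ (mul (inv (graphPt L.shift μ.length t.rng)) t rfl) := by
  induction μ generalizing t with
  | nil =>
    refine Eq.trans ?_ (congrArg (· * _)
      (charFun_of_mem (isClopen_cylinder (L := L) []) (mem_univ t.rng))).symm
    rw [one_mul]
    exact congrArg ξ (inv_graphPt_zero_mul t).symm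
  | cons α μ ih =>
    change (S hL α).1 ((SWord hL μ).1 ξ) t = _
    refine (regRep_graphFun_apply _ _ _ _ _).trans ?_
    rw [ih, ← mul_assoc]
    congr 1
    · exact (charFun_inter ((isClopen_discrete {α}).preimage L.continuous_firstLabel)
        ((isClopen_cylinder μ).preimage L.continuous_shift) t.rng).symm
    · exact congrArg ξ (inv_graphPt_mul_inv_graphPt_one_mul μ.length t)

/-- `S_μ E_v S_μ^*` is the characteristic function of the paths that start with a path labeled `μ`
to the vertex `v`. -/
theorem SWord_mul_EProj_mul_star (hL : L.LeftResolving) (μ : List (Fin N)) {l : ℕ} (v : L.V l) :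
    SWord hL μ * EProj hL v * star (SWord hL μ) = diag hL (charFun
      ((isClopen_cylinder μ).inter
        ((hL.isClopen_initVertex v).preimage (L.continuous_shift.iterate μ.length)))) := by
  refine Subtype.ext (ContinuousLinearMap.ext fun ξ => lp.ext (funext fun t => ?_))
  refine Eq.trans ?_ (regRep_graphFun_zero_apply _ _ _ _).symm
  rw [charFun_inter (isClopen_cylinder μ)
    ((hL.isClopen_initVertex v).preimage (L.continuous_shift.iterate μ.length))]
  change (SWord hL μ).1 ((EProj hL v).1 (star (SWord hL μ).1 ξ)) t = _
  have h₁ := mul_star_apply_of_weighted_comp (SWord hL μ).1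
    (fun t => charFun (isClopen_cylinder μ) t.rng)
    (fun t => mul (inv (graphPt L.shift μ.length t.rng)) t rfl) (SWord_apply hL μ) (by
      intro t t' hc hc' e
      have m : ∀ {x}, charFun (isClopen_cylinder (L := L) μ) x ≠ 0 → x ∈ L.cylinder μ :=
        fun h => by_contra fun h' => h (charFun_of_notMem _ h')
      -- The translated element has range σ^|μ| of the original range, which can be recovered on the
      -- cylinder; degree and source then determine t.
      have e₁ : t.rng = t'.rng :=
        hL.injOn_shift_cylinder μ (m hc) (m hc') (congrArg DRGroupoid.rng e)
      have e₂ : -(μ.length : ℤ) + t.deg = -(μ.length : ℤ) + t'.deg := congrArg deg e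
      have e₃ := congrArg DRGroupoid.src e
      exact DRGroupoid.ext e₁ (by linarith) e₃) ξ t
  -- E_v contributes its characteristic function at σ^|μ|(r(t)); what remains is S_μ S_μ^*, with the
  -- factor |1_μ|² = 1_μ.
  rw [SWord_apply] at h₁ ⊢
  rw [show (EProj hL v).1 (star (SWord hL μ).1 ξ)
    (mul (inv (graphPt L.shift μ.length t.rng)) t rfl) = _ from
      regRep_graphFun_zero_apply _ _ _ _, mul_left_comm, h₁]
  have h₂ : charFun (isClopen_cylinder μ) t.rng *
      starRingEnd ℂ (charFun (isClopen_cylinder μ) t.rng) =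
      charFun (isClopen_cylinder μ) t.rng := by
    by_cases h : t.rng ∈ L.cylinder μ
    · simp [charFun_of_mem _ h]
    · simp [charFun_of_notMem _ h]
  rw [← mul_assoc (charFun (isClopen_cylinder μ) t.rng), h₂, ← mul_assoc,
    mul_comm (charFun (isClopen_cylinder μ) t.rng)]
  rfl

theorem isAdmissible_labels (x : L.XSp) (n : ℕ) :
    L.IsAdmissible ((List.range n).map fun i => (x.1 i).1) := by
  refine ⟨0, (L.initVertex x).1 0, fun i => (x.1 i).1, ?_, by simp⟩
  obtain ⟨e₀, he₀⟩ := L.initVertex_spec x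
  choose e he using x.2.1
  -- A path in the Bratteli diagram climbs one level per edge, so the edges are read off diagonally:
  -- the n-th one at level n.
  refine ⟨fun n => Nat.casesOn n (e₀ 0) fun n => e n (0 + (n + 1)), (he₀ 0).1, fun n => ?_,
    fun n => ?_⟩
  · cases n with
    | zero => exact (he₀ 0).2.1.trans (he 0 1).1.symm
    | succ n => exact (he n (0 + (n + 1))).2.1.trans (he (n + 1) (0 + (n + 1) + 1)).1.symm
  · cases n with
    | zero => exact (he₀ 0).2.2
    | succ n => exact (he n (0 + (n + 1))).2.2

theorem LeftResolving.exists_separating (hL : L.LeftResolving) {x y : L.XSp} (h : x ≠ y) :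
    ∃ (n l : ℕ), y ∉ L.cylinder ((List.range n).map fun i => (x.1 i).1) ∨
      (L.initVertex (L.shift^[n] x)).1 l ≠ (L.initVertex (L.shift^[n] y)).1 l := by
  by_contra! hc
  -- The vertex stored at index i is the initial vertex of σ^(i+1) x, so n = i + 1 controls both
  -- entries at i.
  refine h (Subtype.ext (funext fun i => Prod.ext ?_ (Subtype.ext (funext fun l => ?_))))
  · have := mem_cylinder.1 (hc (i + 1) 0).1
    rw [List.length_map, List.length_range] at this
    exact List.map_inj_left.1 this i (List.mem_range.2 (Nat.lt_succ_self i))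
  · have := (hc (i + 1) l).2
    rw [Function.iterate_succ_apply', Function.iterate_succ_apply', hL.initVertex_shift,
      hL.initVertex_shift, shift_iterate_apply, shift_iterate_apply, zero_add] at this
    exact this

/-- The generators are characteristic functions and the image of C(X) is closed, which gives one
inclusion. For the other, the preimage of the diagonal is a closed *-subalgebra of C(X) that
separates points. -/
theorem DAlg_eq_range_diag (hL : L.LeftResolving) :
    (DAlg hL : Set (OAlg hL)) = range (diag hL) := by
  let D : C(L.XSp, ℂ) →⋆ₐ[ℂ] OAlg hL := unitRep hL.isLocalHomeomorph_shift
  have hD : Isometry D := isometry_unitRep _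
  apply Subset.antisymm
  · have h : DAlg hL ≤ D.range := by
      refine StarSubalgebra.topologicalClosure_minimal (StarAlgebra.adjoin_le ?_) ?_
      · rintro _ ⟨μ, l, v, -, rfl⟩
        exact ⟨_, (SWord_mul_EProj_mul_star hL μ v).symm⟩
      · have : IsClosed (range D) := hD.isClosedEmbedding.isClosed_range
        exact this
    intro T hT
    exact h hT
  · let A : StarSubalgebra ℂ C(L.XSp, ℂ) := (DAlg hL).comap D
    have hA : IsClosed (A : Set C(L.XSp, ℂ)) :=
      (StarSubalgebra.isClosed_topologicalClosure _).preimage hD.continuous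
    have hsep : A.SeparatesPoints := by
      intro x y hxy
      obtain ⟨n, l, h⟩ := hL.exists_separating hxy
      let μ : List (Fin N) := (List.range n).map fun i => (x.1 i).1
      have hμ : μ.length = n := by simp [μ]
      let a : C(L.XSp, ℂ) := charFun ((isClopen_cylinder μ).inter
        ((hL.isClopen_initVertex ((L.initVertex (L.shift^[n] x)).1 l)).preimage
          (L.continuous_shift.iterate μ.length)))
      have ha : a ∈ A := by
        change D a ∈ DAlg hL
        refine StarSubalgebra.le_topologicalClosure _ (StarAlgebra.subset_adjoin ℂ _
          ⟨μ, l, (L.initVertex (L.shift^[n] x)).1 l, isAdmissible_labels x n, ?_⟩)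
        exact (SWord_mul_EProj_mul_star hL μ _).symm
      refine ⟨a, ⟨a, ha, rfl⟩, ?_⟩
      have hx : a x = 1 := by
        refine charFun_of_mem _ ⟨mem_cylinder.2 (by rw [hμ]), ?_⟩
        rw [hμ]
        rfl
      have hy : a y = 0 := by
        refine charFun_of_notMem _ fun hy => ?_
        obtain ⟨h₁, h₂⟩ := hy
        rcases h with h | h
        · exact h h₁
        · rw [hμ] at h₂
          exact h (Eq.symm h₂)
      rw [hx, hy]
      exact one_ne_zero
    have htop := ContinuousMap.starSubalgebra_topologicalClosure_eq_top_of_separatesPoints A hsep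
    rintro _ ⟨a, rfl⟩
    have ha : a ∈ A.topologicalClosure := htop ▸ StarSubalgebra.mem_top
    exact (StarSubalgebra.topologicalClosure_minimal le_rfl hA) ha

end LambdaGraphSystem

end


/-! ### The main theorem. -/

theorem mainTheorem2 {N₁ N₂ : ℕ} (L₁ : LambdaGraphSystem N₁) (L₂ : LambdaGraphSystem N₂)
    (hL₁ : L₁.LeftResolving) (hL₂ : L₂.LeftResolving)
    (hI₁ : L₁.ConditionI) (hI₂ : L₂.ConditionI)
    (h : L₁.XSp ≃ₜ L₂.XSp) (k₁ l₁ : C(L₁.XSp, ℕ)) (k₂ l₂ : C(L₂.XSp, ℕ))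
    (h₁ : ∀ x, L₂.shift^[k₁ x] (h (L₁.shift x)) = L₂.shift^[l₁ x] (h x))
    (h₂ : ∀ y, L₁.shift^[k₂ y] (h.symm (L₂.shift y)) = L₁.shift^[l₂ y] (h.symm y)) :
    ∃ Φ : LambdaGraphSystem.OAlg hL₁ ≃⋆ₐ[ℂ] LambdaGraphSystem.OAlg hL₂,
      Φ '' (LambdaGraphSystem.DAlg hL₁ : Set (LambdaGraphSystem.OAlg hL₁)) =
        (LambdaGraphSystem.DAlg hL₂ : Set (LambdaGraphSystem.OAlg hL₂)) ∧
      (LambdaGraphSystem.DAlg hL₁ : Set (LambdaGraphSystem.OAlg hL₁)) =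
        Set.range (LambdaGraphSystem.diag hL₁) ∧
      (∀ g : C(L₁.XSp, ℂ), Φ (LambdaGraphSystem.diag hL₁ g) =
        LambdaGraphSystem.diag hL₂ (g.comp (h.symm : C(L₂.XSp, L₁.XSp)))) ∧
      ∀ (f : C(L₂.XSp, ℤ)) (t : UnitAddCircle) (a : LambdaGraphSystem.OAlg hL₁),
        Φ (LambdaGraphSystem.gauge hL₁
            (LambdaGraphSystem.Psi (h : C(L₁.XSp, L₂.XSp)) k₁ l₁ f) t a) =
          LambdaGraphSystem.gauge hL₂ f t (Φ a) := by
  let Θ := DRGroupoid.orbitIso hL₁.isLocalHomeomorph_shift hL₂.isLocalHomeomorph_shift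
    (hL₁.topologicallyFree hI₁) (hL₂.topologicallyFree hI₂) h k₁ l₁ k₂ l₂ h₁ h₂
  let Φ := Θ.redAlgEquiv hL₁.isLocalHomeomorph_shift hL₂.isLocalHomeomorph_shift
  have hΦ : ∀ g : C(L₁.XSp, ℂ), Φ (LambdaGraphSystem.diag hL₁ g) =
      LambdaGraphSystem.diag hL₂ (g.comp (h.symm : C(L₂.XSp, L₁.XSp))) := by
    intro g
    refine Subtype.ext ((Θ.conj_regRep hL₁.isLocalHomeomorph_shift
      hL₂.isLocalHomeomorph_shift _).trans ?_)
    rw [Θ.push_graphFun_zero _ hL₂.isLocalHomeomorph_shift]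
    rfl
  refine ⟨Φ, ?_, LambdaGraphSystem.DAlg_eq_range_diag hL₁, hΦ, fun f t a => ?_⟩
  -- Both diagonals are full function algebras, and g ↦ g ∘ h⁻¹ maps one onto the other.
  · rw [LambdaGraphSystem.DAlg_eq_range_diag, LambdaGraphSystem.DAlg_eq_range_diag]
    apply Set.Subset.antisymm
    · rintro _ ⟨_, ⟨g, rfl⟩, rfl⟩
      exact ⟨_, (hΦ g).symm⟩
    · rintro _ ⟨g, rfl⟩
      refine ⟨_, ⟨g.comp (h : C(L₁.XSp, L₂.XSp)), rfl⟩, (hΦ _).trans ?_⟩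
      congr 1
      ext y
      exact congrArg g (h.apply_symm_apply y)
  · exact Θ.redAlgEquiv_gaugeAut hL₁.isLocalHomeomorph_shift hL₂.isLocalHomeomorph_shift
      (LambdaGraphSystem.Psi (h : C(L₁.XSp, L₂.XSp)) k₁ l₁ f) f
      (fun g => DRGroupoid.cocycle_orbitMap h₁ f g) t a
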